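/- Let $O$ be a complete discrete valuation ring with maximal ideal $(\pi)$, residue field of characteristic different from $2$, and fraction field $K$. Let $G$ be a group and $\rho\colon G\to \mathrm{GL}_2(K)$ an irreducible representation. **Tree.** Let $\mathcal X$ be the Bruhat–Tits tree of $\mathrm{PGL}_2(K)$: its vertices are the homothety classes of $O$-lattices in $K^2$, and two vertices are neighbours if they have representatives $\Lambda,\Lambda'$ with $\pi\Lambda\subsetneq\Lambda'\subsetneq\Lambda$. For $A\subseteq M_2(K)$ let $\mathcal X(A)$ be the set of vertices represented by lattices $\Lambda$ with $a\Lambda\subseteq\Lambda$ for all $a\in A$, and put $\mathcal X(\rho)=\mathcal X(\rho(G))$. For a line segment $S$ in $\mathcal X$ (a nonempty geodesic path, finite or infinite) and an integer $r\ge 0$, the band of radius $r$ with nerve $S$ is the set $B(S,r)$ of vertices at distance at most $r$ from $S$; it is called finite or infinite according to whether $S$ is. **Invariants.** For $n\ge 0$, a pair of conjugate characters modulo $\pi^n$ is a pair of homomorphisms $\chi_1,\chi_2\colon G\to(O/\pi^nO)^\times$ such that for all $g\in G$ the characteristic polynomial of $\rho(g)$ has coefficients in $O$ and is congruent to $(t-\chi_1(g))(t-\chi_2(g))$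 modulo $\pi^n$. Let $n(\rho)$ be the supremum of the $n$ for which such a pair exists. If $n(\rho)$ is finite, let $m(\rho)$ be the maximum, over all pairs of conjugate characters $(\chi_1,\chi_2)$ modulo $\pi^{n(\rho)}$, of the largest $m\le n(\rho)$ such that $\chi_1\equiv\chi_2\pmod{\pi^m}$. **Theorem.** Suppose that $\mathcal X(\rho)$ is a finite band of diameter $d$ and radius $r$. Call $g\in G$ a thin element if $\mathcal X(\{\rho(g)\})$ is an infinite band of radius $r$. Then $n(\rho)=d$, and $$m(\rho)=\begin{cases} d &\text{if } d=2r,\\ d&\text{if } d=2r+1 \text{ and } G \text{ contains no thin element},\\ r&\text{otherwise.}\end{cases}$$ -/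

import Mathlib

set_option linter.unusedSectionVars false

namespace BruhatTits

open IsLocalRing
open scoped Pointwise

section Tree

variable (O K : Type*) [CommRing O] [IsDomain O] [IsDiscreteValuationRing O]
  [Field K] [Algebra O K] [IsFractionRing O K]

/-- The lattices in `K²`: finitely generated `O`-submodules that span `K²` over `K`. -/
abbrev Lattice : Type _ :=
  {Λ : Submodule O (Fin 2 → K) // Submodule.IsLattice K Λ}

/-- Two lattices are homothetic if one is a nonzero scalar multiple of the other. -/
def homothety : Setoid (Lattice O K) where
  r Λ Λ' := ∃ c : Kˣ, Λ'.1 = c • Λ.1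
  iseqv :=
    { refl := fun Λ => ⟨1, (one_smul _ _).symm⟩
      symm := by
        rintro Λ Λ' ⟨c, hc⟩
        exact ⟨c⁻¹, by rw [hc, inv_smul_smul]⟩
      trans := by
        rintro Λ Λ' Λ'' ⟨c, hc⟩ ⟨c', hc'⟩
        exact ⟨c' * c, by rw [hc', hc, mul_smul]⟩ }

/-- The vertices of the tree: homothety classes of lattices in `K²`. -/
def Vertex : Type _ := Quotient (homothety O K)

variable {O K}

/-- The homothety class of a lattice. -/
def Lattice.toVertex (Λ : Lattice O K) : Vertex O K := Quotient.mk (homothety O K) Λ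

theorem toVertex_eq_iff {Λ Λ' : Lattice O K} :
    Λ.toVertex = Λ'.toVertex ↔ ∃ c : Kˣ, Λ'.1 = c • Λ.1 :=
  ⟨fun h => Quotient.exact h, fun h => Quotient.sound h⟩

/-- Multiplying by the maximal ideal is the same as multiplying by a uniformiser. -/
theorem exists_maximalIdeal_smul_eq : ∃ p : Kˣ, ∀ M : Submodule O (Fin 2 → K),
    maximalIdeal O • M = p • M := by
  obtain ⟨q, hq⟩ := IsDiscreteValuationRing.exists_irreducible O
  have h0 : algebraMap O K q ≠ 0 := by
    simpa using hq.ne_zero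
  refine ⟨Units.mk0 _ h0, fun M => ?_⟩
  rw [hq.maximalIdeal_eq, Submodule.ideal_span_singleton_smul]
  ext v
  simp only [Submodule.mem_smul_pointwise_iff_exists, Units.smul_mk0, algebraMap_smul]

theorem units_smul_le_of_le {c : Kˣ} {M N : Submodule O (Fin 2 → K)} (h : M ≤ N) :
    c • M ≤ c • N := by
  intro v hv
  obtain ⟨w, hw, rfl⟩ := (Submodule.mem_smul_pointwise_iff_exists _ _ _).1 hv
  exact Submodule.smul_mem_pointwise_smul _ _ _ (h hw)

theorem units_smul_lt_of_lt {c : Kˣ} {M N : Submodule O (Fin 2 → K)} (h : M < N) :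
    c • M < c • N := by
  refine lt_of_le_not_ge (units_smul_le_of_le h.le) fun h' => h.not_ge ?_
  have := units_smul_le_of_le (c := c⁻¹) h'
  simpa using this

theorem not_between {M : Submodule O (Fin 2 → K)} {c : Kˣ}
    (h1 : maximalIdeal O • M < c • M) (h2 : c • M < M) : False := by
  rcases ValuationRing.isInteger_or_isInteger O (c : K) with ⟨a, ha⟩ | ⟨a, ha⟩
  · by_cases hu : IsUnit a
    · apply h2.not_ge
      intro v hv
      obtain ⟨b, hb⟩ := hu.exists_left_inv
      refine (Submodule.mem_smul_pointwise_iff_exists _ _ _).2 ⟨b • v, M.smul_mem b hv, ?_⟩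
      rw [Units.smul_def, ← ha, algebraMap_smul, smul_smul, mul_comm, hb, one_smul]
    · apply h1.not_ge
      intro v hv
      obtain ⟨w, hw, rfl⟩ := (Submodule.mem_smul_pointwise_iff_exists _ _ _).1 hv
      rw [Units.smul_def, ← ha, algebraMap_smul]
      exact Submodule.smul_mem_smul ((mem_maximalIdeal a).2 hu) hw
  · apply h2.not_ge
    intro v hv
    refine (Submodule.mem_smul_pointwise_iff_exists _ _ _).2 ⟨a • v, M.smul_mem a hv, ?_⟩
    rw [Units.smul_def, ← algebraMap_smul K a v, ha, smul_smul, mul_inv_cancel₀ c.ne_zero,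
      one_smul]

variable (O K)

/-- The Bruhat--Tits tree of `PGL₂(K)`: distinct classes `x, y` are neighbours if they have
representatives with `πΛ_x ⊊ Λ_y ⊊ Λ_x`. -/
def tree : SimpleGraph (Vertex O K) where
  Adj x y := ∃ Λ Λ' : Lattice O K, Λ.toVertex = x ∧ Λ'.toVertex = y ∧
    maximalIdeal O • Λ.1 < Λ'.1 ∧ Λ'.1 < Λ.1
  symm := ⟨by
    rintro x y ⟨Λ, Λ', rfl, rfl, h1, h2⟩
    obtain ⟨p, hp⟩ := exists_maximalIdeal_smul_eq (O := O) (K := K)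
    have := Λ.2
    refine ⟨Λ', ⟨p • Λ.1, inferInstance⟩, rfl, (toVertex_eq_iff.2 ⟨p, rfl⟩).symm, ?_, ?_⟩
    · rw [hp]
      exact units_smul_lt_of_lt h2
    · change p • Λ.1 < Λ'.1
      rw [← hp]
      exact h1⟩
  loopless := ⟨by
    rintro x ⟨Λ, Λ', rfl, h, h1, h2⟩
    obtain ⟨c, hc⟩ := toVertex_eq_iff.1 h.symm
    rw [hc] at h1 h2
    exact not_between h1 h2⟩

variable {O K}

/-- A segment of the tree: the image of a nonempty interval of `ℤ` under a
distance-preserving map. The interval, and so the segment, may be finite or infinite. -/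
def IsSegment (S : Set (Vertex O K)) : Prop :=
  ∃ (I : Set ℤ) (f : ℤ → Vertex O K), I.Nonempty ∧ I.OrdConnected ∧
    (∀ i ∈ I, ∀ j ∈ I, ((tree O K).dist (f i) (f j) : ℤ) = |i - j|) ∧ S = f '' I

/-- `B(S, r)`, the set of vertices at distance at most `r` from `S`. -/
def band (S : Set (Vertex O K)) (r : ℕ) : Set (Vertex O K) :=
  {x | ∃ s ∈ S, (tree O K).dist x s ≤ r}

/-- `U` is a band of radius `r` with finite nerve. -/
def IsFiniteBand (U : Set (Vertex O K)) (r : ℕ) : Prop :=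
  ∃ S : Set (Vertex O K), IsSegment S ∧ S.Finite ∧ U = band S r

/-- `U` is a band of radius `r` with infinite nerve. -/
def IsInfiniteBand (U : Set (Vertex O K)) (r : ℕ) : Prop :=
  ∃ S : Set (Vertex O K), IsSegment S ∧ S.Infinite ∧ U = band S r

/-- `d` is the diameter of `U`: the largest distance between two vertices of `U`. -/
def HasDiameter (U : Set (Vertex O K)) (d : ℕ) : Prop :=
  IsGreatest {k : ℕ | ∃ x ∈ U, ∃ y ∈ U, (tree O K).dist x y = k} d

variable (O)

/-- `𝒳(A)`, the set of vertices represented by lattices `Λ` with `aΛ ⊆ Λ` for all `a ∈ A`. -/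
def stableVertices (A : Set (Matrix (Fin 2) (Fin 2) K)) : Set (Vertex O K) :=
  {x | ∃ Λ : Lattice O K, Λ.toVertex = x ∧ ∀ a ∈ A, ∀ v ∈ Λ.1, a.mulVec v ∈ Λ.1}

end Tree

section Representation

variable {G K : Type*} [Group G] [Field K]

/-- The representation of `G` on `K²` given by a homomorphism `G → GL₂(K)`. -/
def toRepresentation (ρ : G →* Matrix.GeneralLinearGroup (Fin 2) K) :
    Representation K G (Fin 2 → K) :=
  ((Matrix.toLinAlgEquiv' : Matrix (Fin 2) (Fin 2) K ≃ₐ[K] _) :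
    Matrix (Fin 2) (Fin 2) K →* ((Fin 2 → K) →ₗ[K] (Fin 2 → K))).comp
      ((Units.coeHom (Matrix (Fin 2) (Fin 2) K)).comp ρ)

variable (O : Type*) [CommRing O] [IsDomain O] [IsDiscreteValuationRing O]
  [Algebra O K] [IsFractionRing O K]

/-- `𝒳(ρ)`, the set of vertices that are stable under `ρ(G)`. -/
def fixedTree (ρ : G →* Matrix.GeneralLinearGroup (Fin 2) K) : Set (Vertex O K) :=
  stableVertices O (Set.range fun g => (ρ g : Matrix (Fin 2) (Fin 2) K))

/-- `g` is a thin element for `ρ` (where `r` is the radius of `𝒳(ρ)`): the vertices stable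
under `ρ(g)` form an infinite band of radius `r`. -/
def IsThin (ρ : G →* Matrix.GeneralLinearGroup (Fin 2) K) (r : ℕ) (g : G) : Prop :=
  IsInfiniteBand (stableVertices O {(ρ g : Matrix (Fin 2) (Fin 2) K)}) r

variable {O}

/-- `(χ₁, χ₂)` is a pair of conjugate characters modulo `πⁿ`: for every `g`, the characteristic
polynomial of `ρ(g)` has coefficients in `O` and is congruent to `(t - χ₁(g))(t - χ₂(g))`
modulo `πⁿ`. -/
def IsConjugatePair (ρ : G →* Matrix.GeneralLinearGroup (Fin 2) K) (n : ℕ)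
    (χ₁ χ₂ : G →* (O ⧸ maximalIdeal O ^ n)ˣ) : Prop :=
  ∀ g : G, ∃ P : Polynomial O,
    P.map (algebraMap O K) = (ρ g : Matrix (Fin 2) (Fin 2) K).charpoly ∧
    P.map (Ideal.Quotient.mk (maximalIdeal O ^ n)) =
      (Polynomial.X - Polynomial.C (χ₁ g : O ⧸ maximalIdeal O ^ n)) *
        (Polynomial.X - Polynomial.C (χ₂ g : O ⧸ maximalIdeal O ^ n))

/-- `k = m(χ₁, χ₂)`: the largest `k ≤ n` such that `χ₁ ≡ χ₂` modulo `πᵏ`. -/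
def IsCongruenceIndex {n : ℕ} (χ₁ χ₂ : G →* (O ⧸ maximalIdeal O ^ n)ˣ) (k : ℕ) : Prop :=
  IsGreatest {m : ℕ | m ≤ n ∧ ∀ g : G,
    ((χ₁ g : O ⧸ maximalIdeal O ^ n) - (χ₂ g : O ⧸ maximalIdeal O ^ n)) ∈
      (maximalIdeal O ^ m).map (Ideal.Quotient.mk (maximalIdeal O ^ n))} k

variable (O)

/-- `n(ρ)`, the supremum of all `n` for which there is a pair of conjugate characters
modulo `πⁿ`. -/
noncomputable def reducibilityIndex (ρ : G →* Matrix.GeneralLinearGroup (Fin 2) K) : ℕ∞ :=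
  ⨆ n ∈ {n : ℕ | ∃ χ₁ χ₂ : G →* (O ⧸ maximalIdeal O ^ n)ˣ, IsConjugatePair ρ n χ₁ χ₂}, (n : ℕ∞)

/-- `k = m(ρ)`: the number `n(ρ)` is finite, and `k` is the maximum of `m(χ₁, χ₂)` over all
pairs `(χ₁, χ₂)` of conjugate characters modulo `π^{n(ρ)}`. -/
def IsMultiplicityIndex (ρ : G →* Matrix.GeneralLinearGroup (Fin 2) K) (k : ℕ) : Prop :=
  ∃ n : ℕ, reducibilityIndex O ρ = n ∧
    IsGreatest {m : ℕ | ∃ χ₁ χ₂ : G →* (O ⧸ maximalIdeal O ^ n)ˣ,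
      IsConjugatePair ρ n χ₁ χ₂ ∧ IsCongruenceIndex χ₁ χ₂ m} k

end Representation

end BruhatTits

/-! Everything is computed in one frame. The two ends of the nerve of `fixedTree O ρ` are the
vertices of `P` and `P * diagonalGL 1 (p ^ l)`, with d = 2r + l (`exists_frame`). A matrix
stabilises a ball of radius r exactly when it is scalar modulo ϖ^r at the centre, so the two end
balls force every ρ(g) into the shape (t + ϖ^r a, ϖ^r b; ϖ^(r+l) c, t - ϖ^r a)
(`exists_coordinates`). The diagonal entries are then multiplicative modulo ϖ^(2r+l), which gives
n(ρ) ≥ d.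

For the upper bound, the fact that the fixed set is no larger than the band is turned into unit
conditions: the diameter yields `exists_isUnit_upper` and `exists_isUnit_lower`, and the radius
yields `exists_isUnit_diagonal` when l ≥ 2. If (χ₁, χ₂) is a conjugate pair and D lifts χ₁ - χ₂,
polarising the trace shows that D(g)D(h) is, up to ϖ^(2r), twice the trace form of the traceless
parts of g and h (`exists_difference`). So modulo ϖ^n this bilinear form is a product of two values
of one linear form; `not_square_discriminant` shows that the unit conditions forbid this once n > d.

For m(ρ), if some a(g) is a unit and l ≥ 1, then D(g)² has valuation exactly 2r modulo ϖ^(2r+1), so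
every pair has index r (`isCongruenceIndex_of_isUnit`). If ϖ^l divides all products a(g)a(h), the
half trace t is itself a character, paired with itself (`exists_isConjugatePair_self`). For l = 0
the second case holds, for l ≥ 2 the first. For l = 1 the alternative is decided by thin elements,
because g is thin exactly when a(g) is a unit (`isInfiniteBand_of_isUnit`,
`not_isInfiniteBand_of_dvd`). -/

namespace BruhatTits

open IsLocalRing
open scoped Pointwise

/-! ### Walks in the tree as chains of lattices. -/

section Walks

variable {O K : Type*} [CommRing O] [IsDomain O] [IsDiscreteValuationRing O]
  [Field K] [Algebra O K] [IsFractionRing O K] {ϖ : O} {p : Kˣ}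

theorem maximalIdeal_smul_eq (hϖ : Irreducible ϖ) (hp : (p : K) = algebraMap O K ϖ)
    (M : Submodule O (Fin 2 → K)) : maximalIdeal O • M = p • M := by
  rw [hϖ.maximalIdeal_eq, Submodule.ideal_span_singleton_smul]
  ext v
  simp only [Submodule.mem_smul_pointwise_iff_exists, Units.smul_def, hp, algebraMap_smul]

theorem unit_pow_smul_le (hp : (p : K) = algebraMap O K ϖ) (m : ℕ)
    (M : Submodule O (Fin 2 → K)) : p ^ m • M ≤ M := by
  intro v hv
  obtain ⟨w, hw, rfl⟩ := (Submodule.mem_smul_pointwise_iff_exists _ _ _).1 hv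
  rw [Units.smul_def, Units.val_pow_eq_pow_val, hp, ← map_pow, algebraMap_smul]
  exact M.smul_mem _ hw

/-- The lattice Λ' + ϖ^m Λ is at most one step away from Λ' and satisfies the hypothesis with m in
place of m + 1. -/
theorem exists_walk_length_le (hϖ : Irreducible ϖ) (hp : (p : K) = algebraMap O K ϖ) (m : ℕ) :
    ∀ Λ Λ' : Lattice O K, p ^ m • Λ.1 ≤ Λ'.1 → Λ'.1 ≤ Λ.1 →
      ∃ w : (tree O K).Walk Λ.toVertex Λ'.toVertex, w.length ≤ m := by
  induction m with
  | zero =>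
    intro Λ Λ' h1 h2
    have : Λ = Λ' := Subtype.ext (le_antisymm (by simpa using h1) h2)
    subst this
    exact ⟨.nil, le_rfl⟩
  | succ m ih =>
    intro Λ Λ' h1 h2
    have := Λ.2
    have := Λ'.2
    let M : Lattice O K := ⟨Λ'.1 ⊔ p ^ m • Λ.1, inferInstance⟩
    obtain ⟨w, hw⟩ := ih Λ M le_sup_right (sup_le h2 (unit_pow_smul_le hp m _))
    have h3 : Λ'.1 ≤ M.1 := le_sup_left
    have h4 : p • M.1 ≤ Λ'.1 := by
      have h5 : p • M.1 = p • Λ'.1 ⊔ p • p ^ m • Λ.1 := Submodule.smul_sup' _ _ _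
      rw [h5, smul_smul, ← pow_succ']
      exact sup_le (by simpa using unit_pow_smul_le hp 1 Λ'.1) h1
    rcases h3.eq_or_lt with h | h
    · have : Λ' = M := Subtype.ext h
      rw [this]
      exact ⟨w, hw.trans m.le_succ⟩
    rcases h4.eq_or_lt with h' | h'
    · have : M.toVertex = Λ'.toVertex := toVertex_eq_iff.2 ⟨p, h'.symm⟩
      rw [← this]
      exact ⟨w, hw.trans m.le_succ⟩
    · have : (tree O K).Adj M.toVertex Λ'.toVertex :=
        ⟨M, Λ', rfl, rfl, by rwa [maximalIdeal_smul_eq hϖ hp], h⟩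
      exact ⟨w.concat this, by simpa using hw⟩

/-- An edge determines its lattices only up to a common homothety, so they are rescaled at each step
to continue the chain already built. -/
theorem exists_lattice_of_walk (hϖ : Irreducible ϖ) (hp : (p : K) = algebraMap O K ϖ)
    {x y : Vertex O K} (w : (tree O K).Walk x y) : ∀ Λ : Lattice O K, Λ.toVertex = x →
      ∃ Λ' : Lattice O K, Λ'.toVertex = y ∧ p ^ w.length • Λ.1 ≤ Λ'.1 ∧ Λ'.1 ≤ Λ.1 := by
  induction w with
  | nil => exact fun Λ h => ⟨Λ, h, by simp, le_rfl⟩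
  | cons hadj w ih =>
    intro Λ hΛ
    obtain ⟨Λ₀, Λ₁, h0, h1, h2, h3⟩ := hadj
    obtain ⟨c, hc⟩ := toVertex_eq_iff.1 (h0.trans hΛ.symm)
    have := Λ₁.2
    let M : Lattice O K := ⟨c • Λ₁.1, inferInstance⟩
    have hM : M.toVertex = Λ₁.toVertex := (toVertex_eq_iff.2 ⟨c, rfl⟩).symm
    obtain ⟨Λ', h4, h5, h6⟩ := ih M (hM.trans h1)
    refine ⟨Λ', h4, ?_, h6.trans ?_⟩
    · refine le_trans ?_ h5
      change p ^ (w.length + 1) • Λ.1 ≤ _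
      rw [pow_succ, mul_smul]
      refine units_smul_le_of_le ?_
      change p • Λ.1 ≤ c • Λ₁.1
      rw [hc, smul_comm, ← maximalIdeal_smul_eq hϖ hp]
      exact units_smul_le_of_le h2.le
    · rw [hc]
      exact units_smul_le_of_le h3.le

end Walks

/-! ### Lattices and stability in terms of invertible matrices. -/

section Matrices

variable (O K : Type*) [CommRing O] [IsDomain O] [IsDiscreteValuationRing O]
  [Field K] [Algebra O K] [IsFractionRing O K]

/-- The matrices with entries in `O`. -/
def integralMatrices : Subring (Matrix (Fin 2) (Fin 2) K) :=
  ((algebraMap O K).mapMatrix : Matrix (Fin 2) (Fin 2) O →+* _).range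

variable {K}

/-- The lattice spanned by the columns of an invertible matrix. -/
def columnLattice (P : GL (Fin 2) K) : Lattice O K :=
  ⟨Submodule.span O (Set.range fun j => (P : Matrix (Fin 2) (Fin 2) K).mulVec (Pi.single j 1)),
    Submodule.fg_span (Set.finite_range _), by
    rw [Submodule.span_span_of_tower]
    have : (Set.range fun j => (P : Matrix (Fin 2) (Fin 2) K).mulVec (Pi.single j 1)) =
        Set.range (P : Matrix (Fin 2) (Fin 2) K).col := by
      congr 1; ext j; simp
    rw [this, ← Matrix.range_mulVecLin, LinearMap.range_eq_top]
    intro v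
    exact ⟨(↑P⁻¹ : Matrix (Fin 2) (Fin 2) K).mulVec v, by
      rw [Matrix.mulVecLin_apply, Matrix.mulVec_mulVec, ← Units.val_mul, mul_inv_cancel]; simp⟩⟩

/-- The vertex of the tree represented by the lattice spanned by the columns of a matrix. -/
def columnVertex (P : GL (Fin 2) K) : Vertex O K := (columnLattice O P).toVertex

variable {O}

theorem mem_integralMatrices {M : Matrix (Fin 2) (Fin 2) K} :
    M ∈ integralMatrices O K ↔ ∃ N : Matrix (Fin 2) (Fin 2) O, N.map (algebraMap O K) = M :=
  Iff.rfl

theorem mem_integralMatrices_iff {M : Matrix (Fin 2) (Fin 2) K} :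
    M ∈ integralMatrices O K ↔ ∀ i j, ∃ a, algebraMap O K a = M i j := by
  rw [mem_integralMatrices]
  constructor
  · rintro ⟨N, rfl⟩ i j
    exact ⟨N i j, rfl⟩
  · intro h
    choose N hN using h
    exact ⟨Matrix.of N, by ext i j; exact hN i j⟩

theorem of_mem_integralMatrices {a b c d : K} :
    !![a, b; c, d] ∈ integralMatrices O K ↔
      ((∃ x, algebraMap O K x = a) ∧ ∃ x, algebraMap O K x = b) ∧
        (∃ x, algebraMap O K x = c) ∧ ∃ x, algebraMap O K x = d := by
  simp [mem_integralMatrices_iff, Fin.forall_fin_two]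

theorem mem_columnLattice {P : GL (Fin 2) K} {v : Fin 2 → K} :
    v ∈ (columnLattice O P).1 ↔
      ∃ c : Fin 2 → O, v = (P : Matrix (Fin 2) (Fin 2) K).mulVec (fun i => algebraMap O K (c i)) := by
  rw [columnLattice, Submodule.mem_span_range_iff_exists_fun]
  refine exists_congr fun c => ?_
  rw [eq_comm]
  have : (fun i => algebraMap O K (c i)) = ∑ i, c i • (Pi.single i 1 : Fin 2 → K) := by
    ext j
    simp [Finset.sum_apply, Pi.single_apply, Algebra.smul_def]
  rw [this, Matrix.mulVec_sum]
  simp only [Matrix.mulVec_smul]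

theorem mulVec_mem_columnLattice {P Q : GL (Fin 2) K} {a : Matrix (Fin 2) (Fin 2) K} :
    (∀ v ∈ (columnLattice O P).1, a.mulVec v ∈ (columnLattice O Q).1) ↔
      ((Q⁻¹).val * a * P.val) ∈ integralMatrices O K := by
  simp only [mem_columnLattice]
  constructor
  · intro h
    have h1 : ∀ j, ∃ c : Fin 2 → O, ((Q⁻¹).val * a * P.val).mulVec
        (Pi.single j 1) = fun i => algebraMap O K (c i) := by
      intro j
      obtain ⟨c, hc⟩ := h _ ⟨Pi.single j 1, rfl⟩
      refine ⟨c, ?_⟩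
      have h2 : (fun i => algebraMap O K ((Pi.single j 1 : Fin 2 → O) i)) = Pi.single j 1 := by
        ext i
        by_cases hij : i = j
        · subst hij; simp
        · simp [hij]
      rw [h2] at hc
      rw [mul_assoc, ← Matrix.mulVec_mulVec, ← Matrix.mulVec_mulVec, hc, Matrix.mulVec_mulVec,
        ← Units.val_mul, inv_mul_cancel, Units.val_one, Matrix.one_mulVec]
    rw [mem_integralMatrices_iff]
    intro i j
    obtain ⟨c, hc⟩ := h1 j
    refine ⟨c i, ?_⟩
    rw [← congrFun hc i]
    simp
  · rintro ⟨N, hN⟩ v ⟨c, rfl⟩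
    refine ⟨N.mulVec c, ?_⟩
    have : (fun i => algebraMap O K (N.mulVec c i)) =
        (N.map (algebraMap O K)).mulVec (fun i => algebraMap O K (c i)) := by
      ext i
      simp [Matrix.mulVec, dotProduct]
    have h2 : N.map (algebraMap O K) = ((Q⁻¹).val * a * P.val) := hN
    rw [this, h2, Matrix.mulVec_mulVec, Matrix.mulVec_mulVec, ← mul_assoc, ← mul_assoc,
      ← Units.val_mul, mul_inv_cancel]
    simp

theorem columnLattice_le_iff {P Q : GL (Fin 2) K} :
    (columnLattice O P).1 ≤ (columnLattice O Q).1 ↔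
      (↑(Q⁻¹ * P) : Matrix (Fin 2) (Fin 2) K) ∈ integralMatrices O K := by
  have := mulVec_mem_columnLattice (O := O) (P := P) (Q := Q) (a := 1)
  simpa [SetLike.le_def] using this

theorem smul_columnLattice (c : Kˣ) (P : GL (Fin 2) K) :
    c • (columnLattice O P).1 = (columnLattice O (c • P)).1 := by
  ext v
  refine (Submodule.mem_smul_pointwise_iff_exists _ _ _).trans ?_
  simp only [mem_columnLattice, Units.val_smul]
  constructor
  · rintro ⟨_, ⟨a, rfl⟩, rfl⟩
    exact ⟨a, by rw [Units.smul_def, Units.smul_def, Matrix.smul_mulVec]⟩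
  · rintro ⟨a, rfl⟩
    exact ⟨_, ⟨a, rfl⟩, by rw [Units.smul_def, Units.smul_def, Matrix.smul_mulVec]⟩

theorem exists_columnLattice_eq (Λ : Lattice O K) : ∃ P : GL (Fin 2) K, columnLattice O P = Λ := by
  have := Λ.2
  have hfin : Module.finrank O Λ.1 = 2 := by
    simpa using Submodule.IsLattice.finrank_of_pi K Λ.1
  let b : Module.Basis (Fin 2) O Λ.1 := Module.finBasisOfFinrankEq O Λ.1 hfin
  let b' := b.extendOfIsLattice K
  let M := (Pi.basisFun K (Fin 2)).toMatrix b'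
  have h1 : M * b'.toMatrix (Pi.basisFun K (Fin 2)) = 1 := Module.Basis.toMatrix_mul_toMatrix_flip _ _
  have h2 : b'.toMatrix (Pi.basisFun K (Fin 2)) * M = 1 := Module.Basis.toMatrix_mul_toMatrix_flip _ _
  refine ⟨⟨M, _, h1, h2⟩, Subtype.ext ?_⟩
  have h3 : (fun j => M.mulVec (Pi.single j 1)) = fun j => (b j).1 := by
    ext j i
    simp [M, b', Module.Basis.toMatrix_apply]
  change Submodule.span O (Set.range fun j => M.mulVec (Pi.single j 1)) = Λ.1
  rw [h3]
  have h4 := b.span_eq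
  have h5 := congrArg (Submodule.map Λ.1.subtype) h4
  rw [Submodule.map_span, ← Set.range_comp, Submodule.map_top, Submodule.range_subtype] at h5
  exact h5

theorem exists_columnVertex_eq (x : Vertex O K) : ∃ P : GL (Fin 2) K, columnVertex O P = x := by
  induction x using Quotient.inductionOn with
  | h Λ =>
    obtain ⟨P, rfl⟩ := exists_columnLattice_eq Λ
    exact ⟨P, rfl⟩

theorem columnVertex_smul (c : Kˣ) (P : GL (Fin 2) K) :
    columnVertex O (c • P) = columnVertex O P :=
  (toVertex_eq_iff.2 ⟨c, (smul_columnLattice c P).symm⟩).symm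

theorem columnVertex_mul_map (P : GL (Fin 2) K) (U : GL (Fin 2) O) :
    columnVertex O (P * Matrix.GeneralLinearGroup.map (algebraMap O K) U) = columnVertex O P := by
  have : columnLattice O (P * Matrix.GeneralLinearGroup.map (algebraMap O K) U) =
      columnLattice O P := by
    refine Subtype.ext (le_antisymm (columnLattice_le_iff.2 ?_) (columnLattice_le_iff.2 ?_))
    · rw [inv_mul_cancel_left]
      exact ⟨U, rfl⟩
    · rw [mul_inv_rev, inv_mul_cancel_right, ← map_inv]
      exact ⟨↑U⁻¹, rfl⟩
  rw [columnVertex, this, columnVertex]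

theorem columnVertex_mem_stableVertices {P : GL (Fin 2) K}
    {A : Set (Matrix (Fin 2) (Fin 2) K)} :
    columnVertex O P ∈ stableVertices O A ↔
      ∀ a ∈ A, ((P⁻¹).val * a * P.val) ∈ integralMatrices O K := by
  constructor
  · rintro ⟨Λ, hΛ, h⟩ a ha
    obtain ⟨c, hc⟩ := toVertex_eq_iff.1 hΛ
    rw [← mulVec_mem_columnLattice, hc]
    intro v hv
    obtain ⟨w, hw, rfl⟩ := (Submodule.mem_smul_pointwise_iff_exists _ _ _).1 hv
    rw [Units.smul_def, Matrix.mulVec_smul]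
    exact Submodule.smul_mem_pointwise_smul _ c _ (h a ha w hw)
  · intro h
    exact ⟨columnLattice O P, rfl, fun a ha => mulVec_mem_columnLattice.2 (h a ha)⟩

end Matrices

/-! ### Cartan decomposition and the distance formula. -/

section Distance

variable {O K : Type*} [CommRing O] [IsDomain O] [IsDiscreteValuationRing O]
  [Field K] [Algebra O K] [IsFractionRing O K] {ϖ : O} {p : Kˣ}

instance : SMulCommClass Kˣ (GL (Fin 2) K) (GL (Fin 2) K) :=
  ⟨fun c P Q => Units.ext (by simp [Units.smul_def])⟩

instance : IsScalarTower Kˣ (GL (Fin 2) K) (GL (Fin 2) K) :=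
  ⟨fun c P Q => Units.ext (by simp [Units.smul_def])⟩

/-- The invertible diagonal matrix with entries `a` and `b`. -/
def diagonalGL (a b : Kˣ) : GL (Fin 2) K where
  val := !![(a : K), 0; 0, b]
  inv := !![((a⁻¹ : Kˣ) : K), 0; 0, (b⁻¹ : Kˣ)]
  val_inv := by ext i j; fin_cases i <;> fin_cases j <;> simp
  inv_val := by ext i j; fin_cases i <;> fin_cases j <;> simp

theorem val_diagonalGL (a b : Kˣ) : (diagonalGL a b).val = !![(a : K), 0; 0, b] := rfl

theorem inv_diagonalGL (a b : Kˣ) : (diagonalGL a b)⁻¹ = diagonalGL a⁻¹ b⁻¹ :=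
  Units.ext rfl

theorem diagonalGL_mul (a b c d : Kˣ) :
    diagonalGL a b * diagonalGL c d = diagonalGL (a * c) (b * d) := by
  ext i j; fin_cases i <;> fin_cases j <;> simp [val_diagonalGL]

/-- The extension of scalars from `GL₂(O)` to `GL₂(K)`. -/
abbrev extendGL (K : Type*) [Field K] [Algebra O K] : GL (Fin 2) O →* GL (Fin 2) K :=
  Matrix.GeneralLinearGroup.map (algebraMap O K)

theorem val_extendGL (U : GL (Fin 2) O) : (extendGL K U).val = U.val.map (algebraMap O K) := rfl

theorem extendGL_mem (U : GL (Fin 2) O) : (extendGL K U).val ∈ integralMatrices O K := ⟨U, rfl⟩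

/-- The invertible matrix with integral entries and unit determinant. -/
noncomputable def integralGL (a b c d : O) (h : IsUnit (a * d - b * c)) : GL (Fin 2) O :=
  Matrix.GeneralLinearGroup.mk'' !![a, b; c, d] (by rwa [Matrix.det_fin_two_of])

theorem val_integralGL (a b c d : O) (h : IsUnit (a * d - b * c)) :
    (integralGL a b c d h).val = !![a, b; c, d] := rfl

theorem val_inv_integralGL (a b c d : O) (h : IsUnit (a * d - b * c)) {e : O}
    (he : e * (a * d - b * c) = 1) :
    (integralGL a b c d h)⁻¹.val = e • !![d, -b; -c, a] := by
  rw [← Units.mul_right_inj (integralGL a b c d h), Units.mul_inv, val_integralGL]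
  ext i j
  fin_cases i <;> fin_cases j <;> simp <;>
    first | ring1 | linear_combination -he

/-- The permutation matrix exchanging the two coordinates. -/
noncomputable def swapGL : GL (Fin 2) O := integralGL 0 1 1 0 (by simp)

theorem swapGL_mul_self : (swapGL : GL (Fin 2) O) * swapGL = 1 := by
  ext i j; fin_cases i <;> fin_cases j <;> simp [swapGL, val_integralGL]

/-- Gaussian elimination with a pivot dividing all entries; the Schur complement d - bc is a unit
times ϖ^k. -/
theorem exists_cartan_of_entry (hϖ : Irreducible ϖ) (hp : (p : K) = algebraMap O K ϖ)
    (T : GL (Fin 2) K) (h0 : T.val 0 0 ≠ 0)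
    (h : ∀ i j, ∃ a, algebraMap O K a = T.val i j / T.val 0 0) :
    ∃ (c : Kˣ) (U V : GL (Fin 2) O) (k : ℕ),
      T = c • (extendGL K U * diagonalGL 1 (p ^ k) * extendGL K V) := by
  obtain ⟨b, hb⟩ := h 0 1
  obtain ⟨c, hc⟩ := h 1 0
  obtain ⟨d, hd⟩ := h 1 1
  rw [eq_div_iff h0] at hb hc hd
  have hdet : T.val.det ≠ 0 := by
    have := T.isUnit
    rw [Matrix.isUnit_iff_isUnit_det] at this
    exact this.ne_zero
  rw [Matrix.det_fin_two] at hdet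
  have hne : d - b * c ≠ 0 := by
    intro h1
    apply hdet
    rw [← hb, ← hc, ← hd, sub_eq_zero.1 h1, map_mul]
    ring
  obtain ⟨k, u, hu⟩ := IsDiscreteValuationRing.eq_unit_mul_pow_irreducible hne hϖ
  refine ⟨Units.mk0 _ h0, integralGL 1 0 c 1 (by simp), integralGL 1 b 0 u (by simp), k, ?_⟩
  have hk : algebraMap O K d = algebraMap O K u * (p : K) ^ k +
      algebraMap O K b * algebraMap O K c := by
    rw [hp, ← map_pow, ← map_mul, ← map_mul, ← map_add, ← hu]; ring_nf
  refine Units.ext ?_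
  simp only [Units.val_smul, Units.val_mul, val_extendGL, val_integralGL, val_diagonalGL]
  ext i j
  fin_cases i <;> fin_cases j <;>
    simp [Units.smul_def, Matrix.mul_apply, Fin.sum_univ_two, ← hb, ← hc, ← hd, hk] <;> ring

theorem exists_cartan (hϖ : Irreducible ϖ) (hp : (p : K) = algebraMap O K ϖ)
    (T : GL (Fin 2) K) : ∃ (c : Kˣ) (U V : GL (Fin 2) O) (k : ℕ),
      T = c • (extendGL K U * diagonalGL 1 (p ^ k) * extendGL K V) := by
  -- The valuation is multiplicative, so an entry of maximal value divides all the others;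
  -- permutations bring it to the corner.
  obtain ⟨⟨i, j⟩, hij⟩ := Finite.exists_max
    (fun ij : Fin 2 × Fin 2 => ValuationRing.valuation O K (T.val ij.1 ij.2))
  have h0 : T.val i j ≠ 0 := by
    intro h0
    have h1 : T.val = 0 := by
      ext i' j'
      have := hij (i', j')
      rw [h0, map_zero, le_zero_iff, map_eq_zero] at this
      exact this
    have := T.isUnit
    rw [h1] at this
    exact not_isUnit_zero this
  have hdiv : ∀ i' j', ∃ a, algebraMap O K a = T.val i' j' / T.val i j := by
    intro i' j'
    have h2 := hij (i', j')
    have : T.val i' j' / T.val i j ∈ (ValuationRing.valuation O K).integer := by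
      rw [Valuation.mem_integer_iff, map_div₀]
      exact div_le_one_of_le₀ h2 zero_le
    exact (ValuationRing.mem_integer_iff O K _).1 this
  have key : ∃ A B : GL (Fin 2) O, ∃ σ τ : Equiv.Perm (Fin 2),
      (extendGL K A * T * extendGL K B).val = T.val.submatrix σ τ ∧ σ 0 = i ∧ τ 0 = j := by
    have h1 : ∀ i : Fin 2, ∃ A : GL (Fin 2) O, ∃ σ : Equiv.Perm (Fin 2), σ 0 = i ∧
        ∀ N : Matrix (Fin 2) (Fin 2) K, (extendGL K A).val * N = N.submatrix σ id ∧
          N * (extendGL K A).val = N.submatrix id σ := by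
      intro i
      fin_cases i
      · exact ⟨1, 1, rfl, fun N => by simp⟩
      · refine ⟨swapGL, Equiv.swap 0 1, rfl, fun N => ⟨?_, ?_⟩⟩ <;>
        · ext i j
          fin_cases i <;> fin_cases j <;>
            simp [swapGL, val_integralGL, Matrix.mul_apply, Fin.sum_univ_two]
    obtain ⟨A, σ, hσ, hA⟩ := h1 i
    obtain ⟨B, τ, hτ, hB⟩ := h1 j
    exact ⟨A, B, σ, τ, by rw [Units.val_mul, Units.val_mul, (hA _).1, (hB _).2]; rfl, hσ, hτ⟩
  obtain ⟨A, B, σ, τ, hT, rfl, rfl⟩ := key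
  obtain ⟨c, U, V, k, h⟩ := exists_cartan_of_entry hϖ hp (extendGL K A * T * extendGL K B)
    (by rw [hT]; exact h0) (by rw [hT]; exact fun i' j' => hdiv _ _)
  refine ⟨c, A⁻¹ * U, V * B⁻¹, k, ?_⟩
  have : T = (extendGL K A)⁻¹ * (extendGL K A * T * extendGL K B) * (extendGL K B)⁻¹ := by group
  rw [this, h, mul_smul_comm, smul_mul_assoc, map_mul, map_mul, map_inv, map_inv]
  simp only [mul_assoc]

/-- Polar coordinates around the vertex of `P`: `U` gives a direction and `k` is the distance
(`dist_branch`). -/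
theorem exists_branch (hϖ : Irreducible ϖ) (hp : (p : K) = algebraMap O K ϖ)
    (P : GL (Fin 2) K) (x : Vertex O K) : ∃ (U : GL (Fin 2) O) (k : ℕ),
      x = columnVertex O (P * extendGL K U * diagonalGL 1 (p ^ k)) := by
  obtain ⟨Q, rfl⟩ := exists_columnVertex_eq x
  obtain ⟨c, U, V, k, h⟩ := exists_cartan hϖ hp (P⁻¹ * Q)
  refine ⟨U, k, ?_⟩
  rw [inv_mul_eq_iff_eq_mul, mul_smul_comm, ← mul_assoc, ← mul_assoc] at h
  rw [h, columnVertex_smul, columnVertex_mul_map]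

theorem diagonalGL_mem (hp : (p : K) = algebraMap O K ϖ) (i j : ℕ) :
    (diagonalGL (p ^ i) (p ^ j)).val ∈ integralMatrices O K := by
  rw [val_diagonalGL, of_mem_integralMatrices]
  exact ⟨⟨⟨ϖ ^ i, by simp [hp]⟩, 0, by simp⟩, ⟨0, by simp⟩, ϖ ^ j, by simp [hp]⟩

theorem tree_connected : (tree O K).Connected := by
  obtain ⟨ϖ, hϖ⟩ := IsDiscreteValuationRing.exists_irreducible O
  obtain ⟨p, hp⟩ : ∃ p : Kˣ, (p : K) = algebraMap O K ϖ :=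
    ⟨Units.mk0 _ (by simpa using hϖ.ne_zero), rfl⟩
  have : Nonempty (Vertex O K) := ⟨columnVertex O 1⟩
  refine ⟨fun x y => ?_⟩
  obtain ⟨P, rfl⟩ := exists_columnVertex_eq x
  obtain ⟨U, k, rfl⟩ := exists_branch hϖ hp P y
  have h1 : (columnLattice O (P * extendGL K U * diagonalGL 1 (p ^ k))).1 ≤
      (columnLattice O P).1 := by
    rw [columnLattice_le_iff, mul_assoc, inv_mul_cancel_left, Units.val_mul]
    exact mul_mem (extendGL_mem U) (by simpa using diagonalGL_mem hp 0 k)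
  have h2 : p ^ k • (columnLattice O P).1 ≤
      (columnLattice O (P * extendGL K U * diagonalGL 1 (p ^ k))).1 := by
    rw [smul_columnLattice, columnLattice_le_iff, mul_smul_comm]
    have : p ^ k • ((P * extendGL K U * diagonalGL 1 (p ^ k))⁻¹ * P) =
        diagonalGL (p ^ k) 1 * extendGL K U⁻¹ := by
      rw [mul_inv_rev, mul_inv_rev, mul_assoc, inv_mul_cancel_right, ← smul_mul_assoc, map_inv]
      congr 1
      rw [inv_diagonalGL]
      ext i j
      fin_cases i <;> fin_cases j <;> simp [val_diagonalGL, Units.smul_def]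
    rw [this, Units.val_mul]
    exact mul_mem (by simpa using diagonalGL_mem hp k 0) (extendGL_mem _)
  obtain ⟨w, -⟩ := exists_walk_length_le hϖ hp k _ _ h2 h1
  exact ⟨w⟩

/-- The scalar `c` chooses the representative cQ with ϖ^m P ⊆ cQ ⊆ P; the two conditions are these
two inclusions. -/
theorem dist_columnVertex_le_iff (hϖ : Irreducible ϖ) (hp : (p : K) = algebraMap O K ϖ)
    {P Q : GL (Fin 2) K} {m : ℕ} :
    (tree O K).dist (columnVertex O P) (columnVertex O Q) ≤ m ↔
      ∃ c : Kˣ, (c • (P⁻¹ * Q)).val ∈ integralMatrices O K ∧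
        ((p ^ m * c⁻¹) • (Q⁻¹ * P)).val ∈ integralMatrices O K := by
  constructor
  · intro h
    obtain ⟨w, hw⟩ := tree_connected.exists_walk_length_eq_dist (columnVertex O P) (columnVertex O Q)
    obtain ⟨Λ, h1, h2, h3⟩ := exists_lattice_of_walk hϖ hp w (columnLattice O P) rfl
    obtain ⟨c, hc⟩ := toVertex_eq_iff.1 (show (columnLattice O Q).toVertex = Λ.toVertex from h1.symm)
    rw [smul_columnLattice] at hc
    rw [hc, columnLattice_le_iff, mul_smul_comm] at h3
    have h4 : p ^ m • (columnLattice O P).1 ≤ (columnLattice O (c • Q)).1 := by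
      rw [← hc]
      refine le_trans ?_ h2
      obtain ⟨e, rfl⟩ := Nat.exists_eq_add_of_le (hw.trans_le h)
      rw [pow_add, mul_smul]
      exact units_smul_le_of_le (unit_pow_smul_le hp _ _)
    rw [smul_columnLattice, columnLattice_le_iff, mul_smul_comm] at h4
    refine ⟨c, h3, ?_⟩
    have : (p ^ m * c⁻¹) • (Q⁻¹ * P) = p ^ m • ((c • Q)⁻¹ * P) := by
      rw [mul_smul, smul_inv, smul_mul_assoc]
    rwa [this]
  · rintro ⟨c, h1, h2⟩
    have h3 : (columnLattice O (c • Q)).1 ≤ (columnLattice O P).1 := by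
      rwa [columnLattice_le_iff, mul_smul_comm]
    have h4 : p ^ m • (columnLattice O P).1 ≤ (columnLattice O (c • Q)).1 := by
      rw [smul_columnLattice, columnLattice_le_iff, mul_smul_comm]
      have : (p ^ m * c⁻¹) • (Q⁻¹ * P) = p ^ m • ((c • Q)⁻¹ * P) := by
        rw [mul_smul, smul_inv, smul_mul_assoc]
      rwa [← this]
    obtain ⟨w, hw⟩ := exists_walk_length_le hϖ hp m _ _ h4 h3
    have h5 : (columnLattice O (c • Q)).toVertex = columnVertex O Q := columnVertex_smul c Q
    rw [← h5]
    exact (SimpleGraph.dist_le w).trans hw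

theorem dist_columnVertex_diagonalGL (hϖ : Irreducible ϖ) (hp : (p : K) = algebraMap O K ϖ)
    (P : GL (Fin 2) K) (a b c d : Kˣ) (k : ℕ) (h : a * d = p ^ k * (b * c)) :
    (tree O K).dist (columnVertex O (P * diagonalGL a b)) (columnVertex O (P * diagonalGL c d)) =
      k := by
  have hd : d = p ^ k * b * c * a⁻¹ := by
    rw [eq_mul_inv_iff_mul_eq, mul_comm, h, mul_assoc]
  subst hd
  have e1 : (P * diagonalGL a b)⁻¹ * (P * diagonalGL c (p ^ k * b * c * a⁻¹)) =
      (c * a⁻¹) • diagonalGL 1 (p ^ k) := by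
    rw [mul_inv_rev, mul_assoc, inv_mul_cancel_left, inv_diagonalGL, diagonalGL_mul]
    ext i j
    fin_cases i <;> fin_cases j <;> simp [val_diagonalGL, Units.smul_def] <;> field_simp
  have e2 : (P * diagonalGL c (p ^ k * b * c * a⁻¹))⁻¹ * (P * diagonalGL a b) =
      (a * c⁻¹) • diagonalGL 1 (p ^ k)⁻¹ := by
    rw [← inv_inj, mul_inv_rev, inv_inv, e1, smul_inv, inv_diagonalGL]
    simp
  refine le_antisymm ?_ ?_
  · rw [dist_columnVertex_le_iff hϖ hp, e1, e2]
    refine ⟨a * c⁻¹, ?_, ?_⟩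
    · rw [smul_smul]
      have : a * c⁻¹ * (c * a⁻¹) = 1 := by group
      rw [this, one_smul]
      simpa using diagonalGL_mem hp 0 k
    · rw [smul_smul]
      have : p ^ k * (a * c⁻¹)⁻¹ * (a * c⁻¹) = p ^ k := by group
      rw [this]
      have : p ^ k • diagonalGL 1 (p ^ k)⁻¹ = diagonalGL (p ^ k) 1 := by
        ext i j
        fin_cases i <;> fin_cases j <;> simp [val_diagonalGL, Units.smul_def]
      rw [this]
      simpa using diagonalGL_mem hp k 0
  · by_contra! hlt
    obtain ⟨m, hm⟩ : ∃ m, m = (tree O K).dist (columnVertex O (P * diagonalGL a b))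
      (columnVertex O (P * diagonalGL c (p ^ k * b * c * a⁻¹))) := ⟨_, rfl⟩
    rw [← hm] at hlt
    obtain ⟨e, h1, h2⟩ := (dist_columnVertex_le_iff hϖ hp).1 hm.ge
    rw [e1] at h1
    rw [e2] at h2
    obtain ⟨x, hx⟩ := mem_integralMatrices_iff.1 h1 0 0
    obtain ⟨y, hy⟩ := mem_integralMatrices_iff.1 h2 1 1
    simp [val_diagonalGL, Units.smul_def] at hx hy
    obtain ⟨j, rfl⟩ := Nat.exists_eq_add_of_lt hlt
    -- The unknown scalar `e` cancels in the product of the two diagonal entries, leaving ϖ^(m-k),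
    -- which is not integral for m < k.
    have h3 : algebraMap O K (x * y * ϖ ^ (j + 1)) = algebraMap O K 1 := by
      rw [map_mul, map_mul, hx, hy, map_pow, ← hp, map_one]
      have := p.ne_zero
      field_simp
      ring
    have h4 := IsFractionRing.injective O K h3
    refine hϖ.not_isUnit (IsUnit.of_mul_eq_one (x * y * ϖ ^ j) ?_)
    rw [← h4]; ring

theorem dist_branch (hϖ : Irreducible ϖ) (hp : (p : K) = algebraMap O K ϖ)
    (P : GL (Fin 2) K) (U : GL (Fin 2) O) (k : ℕ) :
    (tree O K).dist (columnVertex O P) (columnVertex O (P * extendGL K U * diagonalGL 1 (p ^ k))) =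
      k := by
  rw [← columnVertex_mul_map P U]
  have := dist_columnVertex_diagonalGL hϖ hp (P * extendGL K U) 1 1 1 (p ^ k) k (by simp)
  rwa [show diagonalGL (1 : Kˣ) 1 = 1 by
    ext i j; fin_cases i <;> fin_cases j <;> simp [val_diagonalGL], mul_one] at this

end Distance

/-! ### Directions at a vertex as points of the projective line over the residue field. -/

section Branches

variable {O K : Type*} [CommRing O] [IsDomain O] [IsDiscreteValuationRing O]
  [Field K] [Algebra O K] [IsFractionRing O K] {ϖ : O} {p : Kˣ}

theorem val_extendGL_integralGL (a b c d : O) (h : IsUnit (a * d - b * c)) :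
    (extendGL K (integralGL a b c d h)).val =
      !![algebraMap O K a, algebraMap O K b; algebraMap O K c, algebraMap O K d] := by
  ext i j
  fin_cases i <;> fin_cases j <;> rfl

/-- The letters are ordered so that (x, y) is the first column, which carries the direction of the
branch. -/
theorem exists_first_column (U : GL (Fin 2) O) : ∃ x y z w : O, ∃ h : IsUnit (x * w - z * y),
    U = integralGL x z y w h := by
  have h := U.isUnit
  rw [Matrix.isUnit_iff_isUnit_det, Matrix.det_fin_two] at h
  refine ⟨U.val 0 0, U.val 1 0, U.val 0 1, U.val 1 1, h, Units.ext ?_⟩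
  rw [val_integralGL]
  exact Matrix.eta_fin_two _

/-- In the frame `P` the lattice is O(x, y) + ϖ^k O², which does not involve the second column. -/
theorem columnVertex_branch_congr (hp : (p : K) = algebraMap O K ϖ) (P : GL (Fin 2) K)
    (x y z w z' w' : O) (h : IsUnit (x * w - z * y)) (h' : IsUnit (x * w' - z' * y)) (k : ℕ) :
    columnVertex O (P * extendGL K (integralGL x z y w h) * diagonalGL 1 (p ^ k)) =
      columnVertex O (P * extendGL K (integralGL x z' y w' h') * diagonalGL 1 (p ^ k)) := by
  obtain ⟨e, he⟩ := h.exists_left_inv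
  have h1 : IsUnit (1 * (e * (x * w' - z' * y)) - ϖ ^ k * e * (w * z' - z * w') * 0) := by
    rw [mul_zero, sub_zero, one_mul]
    exact (IsUnit.of_mul_eq_one _ he).mul h'
  rw [← columnVertex_mul_map (P * extendGL K (integralGL x z y w h) * diagonalGL 1 (p ^ k))
    (integralGL 1 (ϖ ^ k * e * (w * z' - z * w')) 0 (e * (x * w' - z' * y)) h1)]
  congr 1
  rw [mul_assoc P, mul_assoc P, mul_assoc P]
  congr 1
  have he' := congrArg (algebraMap O K) he
  simp only [map_mul, map_sub, map_one] at he'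
  refine Units.ext ?_
  simp only [Units.val_mul, val_extendGL_integralGL, val_diagonalGL, Matrix.mul_fin_two]
  ext i j
  fin_cases i <;> fin_cases j <;> simp [hp]
  · linear_combination (algebraMap O K ϖ) ^ k * algebraMap O K z' * he'
  · linear_combination (algebraMap O K ϖ) ^ k * algebraMap O K w' * he'

/-- Directions that differ modulo ϖ form a basis of O², so both branches lie in one apartment, on
opposite sides of the vertex. -/
theorem dist_transverse (hϖ : Irreducible ϖ) (hp : (p : K) = algebraMap O K ϖ)
    (P : GL (Fin 2) K) (x y z w x' y' z' w' : O) (h : IsUnit (x * w - z * y))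
    (h' : IsUnit (x' * w' - z' * y')) (hx : IsUnit (x * y' - x' * y)) (m n : ℕ) :
    (tree O K).dist
      (columnVertex O (P * extendGL K (integralGL x z y w h) * diagonalGL 1 (p ^ m)))
      (columnVertex O (P * extendGL K (integralGL x' z' y' w' h') * diagonalGL 1 (p ^ n))) =
        m + n := by
  have hx' : IsUnit (x' * y - x * y') := by rw [← neg_sub]; exact hx.neg
  rw [columnVertex_branch_congr hp P x y z w x' y' h hx m,
    columnVertex_branch_congr hp P x' y' z' w' x y h' hx' n]
  have h1 : columnVertex O (P * extendGL K (integralGL x' x y' y hx') * diagonalGL 1 (p ^ n)) =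
      columnVertex O (P * extendGL K (integralGL x x' y y' hx) * diagonalGL (p ^ n) 1) := by
    rw [← columnVertex_mul_map (P * extendGL K (integralGL x x' y y' hx) * diagonalGL (p ^ n) 1)
      swapGL]
    congr 1
    rw [mul_assoc P, mul_assoc P, mul_assoc P]
    congr 1
    refine Units.ext ?_
    simp only [Units.val_mul, val_extendGL_integralGL, val_diagonalGL, swapGL, Matrix.mul_fin_two]
    ext i j
    fin_cases i <;> fin_cases j <;> simp
  rw [h1, SimpleGraph.dist_comm]
  exact dist_columnVertex_diagonalGL hϖ hp _ _ _ _ _ _ (by rw [one_mul, mul_one, pow_add, mul_comm])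

/-- In a tree, a vertex closer to `y` than `v` lies in the same branch at `v` as `y`. -/
theorem branch_of_dist_le (hϖ : Irreducible ϖ) (hp : (p : K) = algebraMap O K ϖ)
    (P : GL (Fin 2) K) (x y z w : O) (h : IsUnit (x * w - z * y)) (r : ℕ) {s : Vertex O K}
    (hs : (tree O K).dist
      (columnVertex O (P * extendGL K (integralGL x z y w h) * diagonalGL 1 (p ^ (r + 1)))) s ≤ r) :
    ∃ (x' y' z' w' : O) (h' : IsUnit (x' * w' - z' * y')) (k : ℕ), 1 ≤ k ∧
      ϖ ∣ x * y' - x' * y ∧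
      s = columnVertex O (P * extendGL K (integralGL x' z' y' w' h') * diagonalGL 1 (p ^ k)) := by
  obtain ⟨U, k, rfl⟩ := exists_branch hϖ hp P s
  obtain ⟨x', y', z', w', h', rfl⟩ := exists_first_column U
  refine ⟨x', y', z', w', h', k, ?_, ?_, rfl⟩
  · have h1 := dist_branch hϖ hp P (integralGL x z y w h) (r + 1)
    have h2 := dist_branch hϖ hp P (integralGL x' z' y' w' h') k
    have h3 := (tree_connected (O := O) (K := K)).dist_triangle (u := columnVertex O P)
      (v := columnVertex O (P * extendGL K (integralGL x' z' y' w' h') * diagonalGL 1 (p ^ k)))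
      (w := columnVertex O (P * extendGL K (integralGL x z y w h) * diagonalGL 1 (p ^ (r + 1))))
    rw [h1, h2, SimpleGraph.dist_comm] at h3
    omega
  · by_contra hdvd
    have hu : IsUnit (x * y' - x' * y) := by
      by_contra hu
      rw [← mem_nonunits_iff, ← mem_maximalIdeal, hϖ.maximalIdeal_eq,
        Ideal.mem_span_singleton] at hu
      exact hdvd hu
    rw [dist_transverse hϖ hp P x y z w x' y' z' w' h h' hu] at hs
    omega

theorem isUnit_iff_not_dvd (hϖ : Irreducible ϖ) {a : O} : IsUnit a ↔ ¬ ϖ ∣ a := by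
  rw [← Ideal.mem_span_singleton, ← hϖ.maximalIdeal_eq, mem_maximalIdeal, mem_nonunits_iff, not_not]

/-- Replacing two directions by others with the same residues keeps them distinct. -/
theorem isUnit_cross_of_dvd (hϖ : Irreducible ϖ) {x y x₁ y₁ x₂ y₂ u v : O}
    (h₁ : IsUnit x₁ ∨ IsUnit y₁) (h₂ : IsUnit x₂ ∨ IsUnit y₂)
    (hx₁ : ϖ ∣ x * y₁ - x₁ * y) (hx₂ : ϖ ∣ u * y₂ - x₂ * v) (h : IsUnit (x * v - u * y)) :
    IsUnit (x₁ * y₂ - x₂ * y₁) := by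
  have hpr := hϖ.prime
  rw [isUnit_iff_not_dvd hϖ] at h ⊢
  simp only [isUnit_iff_not_dvd hϖ] at h₁ h₂
  have hred : ∀ a : O, ϖ ∣ a ↔ residue O a = 0 := by
    intro a
    rw [residue_eq_zero_iff, hϖ.maximalIdeal_eq, Ideal.mem_span_singleton]
  simp only [hred, map_sub, map_mul] at *
  generalize residue O x = x at *
  generalize residue O y = y at *
  generalize residue O u = u at *
  generalize residue O v = v at *
  generalize residue O x₁ = x₁ at *
  generalize residue O y₁ = y₁ at *
  generalize residue O x₂ = x₂ at *
  generalize residue O y₂ = y₂ at *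
  intro h0
  apply h
  have key : ∀ {x y x₁ y₁ : ResidueField O}, ¬x₁ = 0 ∨ ¬y₁ = 0 → x * y₁ - x₁ * y = 0 →
      ∃ c, x = c * x₁ ∧ y = c * y₁ := by
    rintro x y x₁ y₁ (h | h) h'
    · exact ⟨x / x₁, by field_simp, by field_simp; linear_combination -h'⟩
    · exact ⟨y / y₁, by field_simp; linear_combination h', by field_simp⟩
  obtain ⟨c, rfl, rfl⟩ := key h₁ hx₁
  obtain ⟨d, rfl, rfl⟩ := key h₂ hx₂
  linear_combination c * d * h0

end Branches

/-! ### Balls, bands and stability. -/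

section Bands

variable {O K : Type*} [CommRing O] [IsDomain O] [IsDiscreteValuationRing O]
  [Field K] [Algebra O K] [IsFractionRing O K] {ϖ : O} {p : Kˣ}

theorem isUnit_or_isUnit_of_det {x y z w : O} (h : IsUnit (x * w - z * y)) :
    IsUnit x ∨ IsUnit y := by
  by_contra! h'
  have hx := (mem_maximalIdeal x).2 h'.1
  have hy := (mem_maximalIdeal y).2 h'.2
  exact (mem_maximalIdeal _).1
    (sub_mem (Ideal.mul_mem_right w _ hx) (Ideal.mul_mem_left _ z hy)) h

theorem exists_uniformizer (O K : Type*) [CommRing O] [IsDomain O] [IsDiscreteValuationRing O]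
    [Field K] [Algebra O K] [IsFractionRing O K] :
    ∃ (ϖ : O) (p : Kˣ), Irreducible ϖ ∧ (p : K) = algebraMap O K ϖ := by
  obtain ⟨ϖ, hϖ⟩ := IsDiscreteValuationRing.exists_irreducible O
  exact ⟨ϖ, Units.mk0 _ (by simpa using hϖ.ne_zero), hϖ, rfl⟩

/-- A band of radius `r` does not contain a ball of larger radius. -/
theorem not_ball_subset_band {S : Set (Vertex O K)} (hS : IsSegment S) (r : ℕ) (v : Vertex O K) :
    ¬ {y | (tree O K).dist v y ≤ r + 1} ⊆ band S r := by
  intro hsub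
  obtain ⟨ϖ, p, hϖ, hp⟩ := exists_uniformizer O K
  obtain ⟨I, f, -, -, hf, rfl⟩ := hS
  obtain ⟨P, rfl⟩ := exists_columnVertex_eq v
  have key : ∀ x y z w : O, IsUnit (x * w - z * y) →
      ∃ (i : ℤ) (x' y' z' w' : O) (h' : IsUnit (x' * w' - z' * y')) (k : ℕ), i ∈ I ∧ 1 ≤ k ∧
      ϖ ∣ x * y' - x' * y ∧
      f i = columnVertex O (P * extendGL K (integralGL x' z' y' w' h') * diagonalGL 1 (p ^ k)) := by
    intro x y z w h
    obtain ⟨_, ⟨i, hi, rfl⟩, hd⟩ := hsub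
      (show columnVertex O (P * extendGL K (integralGL x z y w h) * diagonalGL 1 (p ^ (r + 1))) ∈
        {y | (tree O K).dist (columnVertex O P) y ≤ r + 1} from (dist_branch hϖ hp _ _ _).le)
    obtain ⟨x', y', z', w', h', k, h1, h2, h3⟩ := branch_of_dist_le hϖ hp P x y z w h r hd
    exact ⟨i, x', y', z', w', h', k, hi, h1, h2, h3⟩
  -- Three directions exist over any residue field. The segment would enter all three branches,
  -- giving integers with pairwise distances k₁ + k₂, k₁ + k₃, k₂ + k₃ and all kᵢ ≥ 1; on a line one
  -- distance is the sum of the other two, which is impossible.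
  obtain ⟨i₁, x₁, y₁, z₁, w₁, h₁, k₁, hi₁, hk₁, hc₁, hf₁⟩ := key 1 0 0 1 (by simp)
  obtain ⟨i₂, x₂, y₂, z₂, w₂, h₂, k₂, hi₂, hk₂, hc₂, hf₂⟩ := key 0 1 (-1) 0 (by simp)
  obtain ⟨i₃, x₃, y₃, z₃, w₃, h₃, k₃, hi₃, hk₃, hc₃, hf₃⟩ := key 1 1 0 1 (by simp)
  have hu₁ := isUnit_or_isUnit_of_det h₁
  have hu₂ := isUnit_or_isUnit_of_det h₂
  have hu₃ := isUnit_or_isUnit_of_det h₃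
  have d12 := hf i₁ hi₁ i₂ hi₂
  have d13 := hf i₁ hi₁ i₃ hi₃
  have d23 := hf i₂ hi₂ i₃ hi₃
  rw [hf₁, hf₂, dist_transverse hϖ hp P x₁ y₁ z₁ w₁ x₂ y₂ z₂ w₂ h₁ h₂
    (isUnit_cross_of_dvd hϖ hu₁ hu₂ hc₁ hc₂ (by simp))] at d12
  rw [hf₁, hf₃, dist_transverse hϖ hp P x₁ y₁ z₁ w₁ x₃ y₃ z₃ w₃ h₁ h₃
    (isUnit_cross_of_dvd hϖ hu₁ hu₃ hc₁ hc₃ (by simp))] at d13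
  rw [hf₂, hf₃, dist_transverse hϖ hp P x₂ y₂ z₂ w₂ x₃ y₃ z₃ w₃ h₂ h₃
    (isUnit_cross_of_dvd hϖ hu₂ hu₃ hc₂ hc₃ (by simp))] at d23
  push_cast at d12 d13 d23
  rcases abs_cases (i₁ - i₂) with h | h <;> rcases abs_cases (i₁ - i₃) with h' | h' <;>
    rcases abs_cases (i₂ - i₃) with h'' | h'' <;> omega

/-- Changing frame over distance m costs at most ϖ^m, so a matrix that is scalar modulo ϖ^m stays
integral. -/
theorem mem_stableVertices_of_dist_le {P : GL (Fin 2) K} {y : Vertex O K} {m : ℕ}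
    (hϖ : Irreducible ϖ) (hp : (p : K) = algebraMap O K ϖ)
    (hy : (tree O K).dist (columnVertex O P) y ≤ m) {A : Set (Matrix (Fin 2) (Fin 2) K)}
    (hA : ∀ a ∈ A, ∃ (t : O), ∃ W ∈ integralMatrices O K,
      (P⁻¹).val * a * P.val = algebraMap O K t • 1 + (p : K) ^ m • W) :
    y ∈ stableVertices O A := by
  obtain ⟨Q, rfl⟩ := exists_columnVertex_eq y
  rw [columnVertex_mem_stableVertices]
  intro a ha
  obtain ⟨t, W, hW, h⟩ := hA a ha
  obtain ⟨c, h1, h2⟩ := (dist_columnVertex_le_iff hϖ hp).1 hy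
  have e1 : (Q⁻¹).val * a * Q.val =
      (Q⁻¹ * P).val * ((P⁻¹).val * a * P.val) * (P⁻¹ * Q).val := by
    rw [Units.val_mul, Units.val_mul]
    simp only [mul_assoc, Units.mul_inv_cancel_left]
  have e2 : (Q⁻¹ * P).val * (P⁻¹ * Q).val = 1 := by
    rw [← Units.val_mul]; simp
  have e3 : (Q⁻¹).val * a * Q.val = algebraMap O K t • 1 +
      ((p ^ m * c⁻¹) • (Q⁻¹ * P)).val * W * (c • (P⁻¹ * Q)).val := by
    rw [e1, h, mul_add, add_mul, mul_smul_comm, mul_one, smul_mul_assoc, e2]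
    congr 1
    simp only [Units.val_smul, Units.smul_def, mul_smul_comm, smul_mul_assoc, smul_smul,
      Units.val_mul, Units.val_pow_eq_pow_val]
    congr 1
    rw [mul_comm (c : K), mul_assoc, ← Units.val_mul, inv_mul_cancel]
    simp
  rw [e3]
  refine add_mem ⟨t • 1, ?_⟩ (mul_mem (mul_mem h2 hW) h1)
  ext i j
  by_cases hij : i = j <;> simp [hij]

/-- The condition is det(v, Bv) ≡ 0 for v = (x, y): the direction is an eigenvector of the matrix
modulo ϖ^k. -/
theorem columnVertex_branch_mem_stableVertices (hp : (p : K) = algebraMap O K ϖ)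
    {P : GL (Fin 2) K} {a : Matrix (Fin 2) (Fin 2) K} {α β γ δ : O}
    (hB : (P⁻¹).val * a * P.val = !![α, β; γ, δ].map (algebraMap O K))
    (x y z w : O) (h : IsUnit (x * w - z * y)) (k : ℕ) :
    columnVertex O (P * extendGL K (integralGL x z y w h) * diagonalGL 1 (p ^ k)) ∈
      stableVertices O {a} ↔ ϖ ^ k ∣ x * (γ * x + δ * y) - y * (α * x + β * y) := by
  obtain ⟨e, he⟩ := h.exists_left_inv
  have hinv : (extendGL K (integralGL x z y w h))⁻¹.val =
      (algebraMap O K e) • !![algebraMap O K w, -algebraMap O K z; -algebraMap O K y, algebraMap O K x] := by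
    rw [← map_inv, val_extendGL, val_inv_integralGL _ _ _ _ _ he]
    ext i j; fin_cases i <;> fin_cases j <;> simp
  have e1 : ((P * extendGL K (integralGL x z y w h) * diagonalGL 1 (p ^ k))⁻¹).val * a *
      (P * extendGL K (integralGL x z y w h) * diagonalGL 1 (p ^ k)).val =
      (diagonalGL 1 (p ^ k))⁻¹.val * ((extendGL K (integralGL x z y w h))⁻¹.val *
      ((P⁻¹).val * a * P.val) * (extendGL K (integralGL x z y w h)).val) *
      (diagonalGL 1 (p ^ k)).val := by
    simp only [mul_inv_rev, Units.val_mul, mul_assoc]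
  have e0 : !![α, β; γ, δ].map (algebraMap O K) =
    !![algebraMap O K α, algebraMap O K β; algebraMap O K γ, algebraMap O K δ] := by
    ext i j; fin_cases i <;> fin_cases j <;> rfl
  have hpk : (p : K) ^ k ≠ 0 := pow_ne_zero _ p.ne_zero
  rw [columnVertex_mem_stableVertices]
  simp only [Set.mem_singleton_iff, forall_eq]
  rw [e1, hB, hinv, inv_diagonalGL, val_diagonalGL, val_diagonalGL, val_extendGL_integralGL, e0,
    Matrix.smul_of]
  simp only [Matrix.smul_cons, Matrix.smul_empty, Matrix.mul_fin_two, of_mem_integralMatrices,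
    smul_eq_mul]
  constructor
  · rintro ⟨-, ⟨b, hb⟩, -⟩
    have h2 : algebraMap O K (ϖ ^ k * b) =
        algebraMap O K (e * (x * (γ * x + δ * y) - y * (α * x + β * y))) := by
      rw [map_mul, hb, map_pow, ← hp]
      simp
      field_simp
      ring
    have h3 := IsFractionRing.injective O K h2
    refine ⟨(x * w - z * y) * b, ?_⟩
    linear_combination -(x * w - z * y) * h3 -
      (x * (γ * x + δ * y) - y * (α * x + β * y)) * he
  · rintro ⟨b, hb⟩
    refine ⟨⟨⟨e * (w * (α * x + β * y) - z * (γ * x + δ * y)), ?_⟩,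
      ⟨e * (w * (α * z + β * w) - z * (γ * z + δ * w)) * ϖ ^ k, ?_⟩⟩, ⟨e * b, ?_⟩,
      ⟨e * (x * (γ * z + δ * w) - y * (α * z + β * w)), ?_⟩⟩
    · simp; ring
    · simp [← hp]; ring
    · have hb' := congrArg (algebraMap O K) hb
      simp only [map_sub, map_mul, map_add, map_pow, ← hp] at hb'
      simp
      field_simp
      linear_combination -algebraMap O K e * hb'
    · simp
      field_simp
      ring

end Bands

/-! ### The frame of the band and the unit conditions imposed by its shape. -/

section Frames

variable {O K : Type*} [CommRing O] [IsDomain O] [IsDiscreteValuationRing O]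
  [Field K] [Algebra O K] [IsFractionRing O K] {ϖ : O} {p : Kˣ}

theorem diagonalGL_one_one : diagonalGL (1 : Kˣ) 1 = 1 := by
  ext i j; fin_cases i <;> fin_cases j <;> simp [val_diagonalGL]

/-- A finite band contains the balls around the ends of its nerve. -/
theorem exists_frame (hϖ : Irreducible ϖ) (hp : (p : K) = algebraMap O K ϖ)
    {U : Set (Vertex O K)} {r d : ℕ} (hU : IsFiniteBand U r) (hd : HasDiameter U d) :
    ∃ (P : GL (Fin 2) K) (l : ℕ), d = 2 * r + l ∧
      (∀ y, (tree O K).dist (columnVertex O P) y ≤ r → y ∈ U) ∧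
      ∀ y, (tree O K).dist (columnVertex O (P * diagonalGL 1 (p ^ l))) y ≤ r → y ∈ U := by
  obtain ⟨S, ⟨I, f, hne, -, hf, rfl⟩, hfin, rfl⟩ := hU
  have hinj : Set.InjOn f I := by
    intro i hi j hj hij
    have := hf i hi j hj
    rw [hij, SimpleGraph.dist_self] at this
    exact sub_eq_zero.1 (abs_eq_zero.1 this.symm)
  have hI : I.Finite := hfin.of_finite_image hinj
  obtain ⟨i₀, hi₀, hmin⟩ := Set.exists_min_image I id hI hne
  obtain ⟨i₁, hi₁, hmax⟩ := Set.exists_max_image I id hI hne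
  simp only [id] at hmin hmax
  obtain ⟨P₀, hP₀⟩ := exists_columnVertex_eq (f i₀)
  obtain ⟨V, l, hl⟩ := exists_branch hϖ hp P₀ (f i₁)
  have hd01 := hf i₀ hi₀ i₁ hi₁
  rw [← hP₀, hl, dist_branch hϖ hp, abs_sub_comm, abs_of_nonneg (sub_nonneg.2 (hmin _ hi₁))] at hd01
  have htri := fun x y z => (tree_connected (O := O) (K := K)).dist_triangle (u := x) (v := y) (w := z)
  have hb0 : ∀ y, (tree O K).dist (columnVertex O (P₀ * extendGL K V)) y ≤ r →
      y ∈ band (f '' I) r := by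
    intro y hy
    refine ⟨f i₀, ⟨i₀, hi₀, rfl⟩, ?_⟩
    rwa [← hP₀, ← columnVertex_mul_map P₀ V, SimpleGraph.dist_comm]
  have hb1 : ∀ y, (tree O K).dist
      (columnVertex O (P₀ * extendGL K V * diagonalGL 1 (p ^ l))) y ≤ r →
      y ∈ band (f '' I) r := by
    intro y hy
    refine ⟨f i₁, ⟨i₁, hi₁, rfl⟩, ?_⟩
    rwa [hl, SimpleGraph.dist_comm]
  refine ⟨P₀ * extendGL K V, l, le_antisymm ?_ ?_, hb0, hb1⟩
  · obtain ⟨x, ⟨_, ⟨i, hi, rfl⟩, hxi⟩, y, ⟨_, ⟨j, hj, rfl⟩, hyj⟩, hxy⟩ := hd.1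
    have h1 := htri x (f i) y
    have h2 := htri (f i) (f j) y
    rw [SimpleGraph.dist_comm (u := f j)] at h2
    have h3 := hf i hi j hj
    have h4 : |i - j| ≤ l := by
      rw [hd01, abs_le]
      have := hmin i hi
      have := hmin j hj
      have := hmax i hi
      have := hmax j hj
      constructor <;> omega
    omega
  -- Extending the apartment of the frame by r beyond each end gives two vertices of the band at
  -- distance 2r + l.
  · refine hd.2 ⟨columnVertex O (P₀ * extendGL K V * diagonalGL (p ^ r) 1), hb0 _ ?_,
      columnVertex O (P₀ * extendGL K V * diagonalGL 1 (p ^ (l + r))), hb1 _ ?_, ?_⟩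
    · have := dist_columnVertex_diagonalGL hϖ hp (P₀ * extendGL K V) (p ^ r) 1 1 1 r (by simp)
      rw [diagonalGL_one_one, mul_one] at this
      rw [SimpleGraph.dist_comm, this]
    · exact (dist_columnVertex_diagonalGL hϖ hp _ 1 (p ^ l) 1 (p ^ (l + r)) r
        (by rw [one_mul, mul_one, pow_add, mul_comm])).le
    · exact dist_columnVertex_diagonalGL hϖ hp _ _ _ _ _ _
        (by rw [one_mul, mul_one, ← pow_add]; congr 1; ring)

theorem conj_diagonalGL {P : GL (Fin 2) K} {M : Matrix (Fin 2) (Fin 2) K} {α β γ δ : K}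
    (h : (P⁻¹).val * M * P.val = !![α, β; γ, δ]) (q : Kˣ) :
    ((P * diagonalGL 1 q)⁻¹).val * M * (P * diagonalGL 1 q).val = !![α, β * q; q⁻¹ * γ, δ] := by
  have : ((P * diagonalGL 1 q)⁻¹).val * M * (P * diagonalGL 1 q).val =
      (diagonalGL 1 q)⁻¹.val * ((P⁻¹).val * M * P.val) * (diagonalGL 1 q).val := by
    simp only [mul_inv_rev, Units.val_mul, mul_assoc]
  have hq := q.ne_zero
  rw [this, h, inv_diagonalGL, val_diagonalGL, val_diagonalGL, Matrix.mul_fin_two,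
    Matrix.mul_fin_two]
  ext i j
  fin_cases i <;> fin_cases j <;> simp
  field_simp

theorem conj_swapGL {P : GL (Fin 2) K} {M : Matrix (Fin 2) (Fin 2) K} {α β γ δ : K}
    (h : (P⁻¹).val * M * P.val = !![α, β; γ, δ]) :
    ((P * extendGL K (swapGL : GL (Fin 2) O))⁻¹).val * M *
      (P * extendGL K (swapGL : GL (Fin 2) O)).val = !![δ, γ; β, α] := by
  have : ((P * extendGL K (swapGL : GL (Fin 2) O))⁻¹).val * M *
      (P * extendGL K (swapGL : GL (Fin 2) O)).val =
      (extendGL K (swapGL : GL (Fin 2) O))⁻¹.val * ((P⁻¹).val * M * P.val) *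
        (extendGL K (swapGL : GL (Fin 2) O)).val := by
    simp only [mul_inv_rev, Units.val_mul, mul_assoc]
  have hs : (extendGL K (swapGL : GL (Fin 2) O))⁻¹ =
      extendGL K (swapGL : GL (Fin 2) O) := by
    rw [inv_eq_iff_mul_eq_one, ← map_mul, swapGL_mul_self, map_one]
  rw [this, h, hs, swapGL, val_extendGL_integralGL, Matrix.mul_fin_two, Matrix.mul_fin_two]
  ext i j
  fin_cases i <;> fin_cases j <;> simp

theorem map_fin_two (α β γ δ : O) : !![α, β; γ, δ].map (algebraMap O K) =
    !![algebraMap O K α, algebraMap O K β; algebraMap O K γ, algebraMap O K δ] := by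
  ext i j; fin_cases i <;> fin_cases j <;> rfl

/-- The directions (1,0), (0,1) and (1,1) must all be eigenvectors modulo ϖ^r, so the matrix is
scalar modulo ϖ^r. -/
theorem congruence_of_ball (hϖ : Irreducible ϖ) (hp : (p : K) = algebraMap O K ϖ) {P : GL (Fin 2) K}
    {M : Matrix (Fin 2) (Fin 2) K} {r : ℕ}
    (h : ∀ y, (tree O K).dist (columnVertex O P) y ≤ r → y ∈ stableVertices O {M}) :
    ∃ α β γ δ : O, (P⁻¹).val * M * P.val = !![α, β; γ, δ].map (algebraMap O K) ∧
      ϖ ^ r ∣ β ∧ ϖ ^ r ∣ γ ∧ ϖ ^ r ∣ α - δ := by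
  have h0 := h (columnVertex O P) (by simp)
  rw [columnVertex_mem_stableVertices] at h0
  obtain ⟨B, hB⟩ := h0 M rfl
  have hB' : (P⁻¹).val * M * P.val = !![B 0 0, B 0 1; B 1 0, B 1 1].map (algebraMap O K) := by
    rw [← Matrix.eta_fin_two B]; exact hB.symm
  have key := fun x y z w hu => (columnVertex_branch_mem_stableVertices hp hB' x y z w hu r).1
    (h _ (dist_branch hϖ hp P (integralGL x z y w hu) r).le)
  have k1 := key 1 0 0 1 (by simp)
  have k2 := key 0 1 (-1) 0 (by simp)
  have k3 := key 1 1 0 1 (by simp)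
  simp only [mul_one, mul_zero, zero_mul, one_mul, add_zero, zero_add, sub_zero, zero_sub,
    dvd_neg] at k1 k2 k3
  refine ⟨_, _, _, _, hB', k2, k1, ?_⟩
  have := dvd_sub (dvd_sub k1 k2) k3
  ring_nf at this ⊢
  exact this

/-- The shape of the matrices stabilising the balls of radius `r` around two vertices at
distance `l`. -/
theorem exists_coordinates (hϖ : Irreducible ϖ) (hp : (p : K) = algebraMap O K ϖ)
    (h2 : IsUnit (2 : O)) {P : GL (Fin 2) K} {M : Matrix (Fin 2) (Fin 2) K} {r l : ℕ}
    (h : ∀ y, (tree O K).dist (columnVertex O P) y ≤ r → y ∈ stableVertices O {M})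
    (h' : ∀ y, (tree O K).dist (columnVertex O (P * diagonalGL 1 (p ^ l))) y ≤ r →
      y ∈ stableVertices O {M}) :
    ∃ t a b c : O, (P⁻¹).val * M * P.val =
      !![t + ϖ ^ r * a, ϖ ^ r * b; ϖ ^ (r + l) * c, t - ϖ ^ r * a].map (algebraMap O K) := by
  obtain ⟨α, β, γ, δ, hB, ⟨b, rfl⟩, -, a, ha⟩ := congruence_of_ball hϖ hp h
  obtain ⟨α', β', γ', δ', hB', -, ⟨c, rfl⟩, -⟩ := congruence_of_ball hϖ hp h'
  obtain ⟨e, he⟩ := h2.exists_left_inv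
  rw [map_fin_two] at hB hB'
  rw [conj_diagonalGL hB] at hB'
  have h10 := congrFun (congrFun hB' 1) 0
  simp at h10
  -- Passing to the other end divides the lower-left entry by ϖ^l, and there it is still divisible
  -- by ϖ^r.
  have hγ : γ = ϖ ^ (r + l) * c := by
    apply IsFractionRing.injective O K
    rw [map_mul, map_pow, ← hp, pow_add]
    have := p.ne_zero
    field_simp at h10
    rw [h10, ← hp]
    ring
  have e1 : α = e * (α + δ) + ϖ ^ r * (e * a) := by
    linear_combination -α * he + e * ha
  have e2 : δ = e * (α + δ) - ϖ ^ r * (e * a) := by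
    linear_combination -δ * he - e * ha
  refine ⟨e * (α + δ), e * a, b, c, ?_⟩
  rw [map_fin_two, ← e1, ← e2, ← hγ, hB]

variable {ι : Type*} {M : ι → Matrix (Fin 2) (Fin 2) K}

theorem columnVertex_mem_range {P : GL (Fin 2) K} :
    columnVertex O P ∈ stableVertices O (Set.range M) ↔
      ∀ i, columnVertex O P ∈ stableVertices O {M i} := by
  simp [columnVertex_mem_stableVertices]

/-- The expression is the eigenvector condition for (x, 1), divided by -ϖ^r. Were it always
divisible by ϖ, the vertex at distance r + 1 in that direction would be stable, at distance 2r + l +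
1 from the stable vertex at distance r + l in direction (1, 0). -/
theorem exists_isUnit_upper (hϖ : Irreducible ϖ) (hp : (p : K) = algebraMap O K ϖ)
    {P : GL (Fin 2) K} {r l : ℕ} {t a b c : ι → O}
    (hB : ∀ i, (P⁻¹).val * M i * P.val = !![t i + ϖ ^ r * a i, ϖ ^ r * b i;
      ϖ ^ (r + l) * c i, t i - ϖ ^ r * a i].map (algebraMap O K))
    (hX : ∀ x ∈ stableVertices O (Set.range M), ∀ y ∈ stableVertices O (Set.range M),
      (tree O K).dist x y ≤ 2 * r + l) (x : O) :
    ∃ i, IsUnit (2 * a i * x + b i - ϖ ^ l * c i * x ^ 2) := by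
  by_contra! hcon
  have hdvd : ∀ i, ϖ ∣ 2 * a i * x + b i - ϖ ^ l * c i * x ^ 2 := by
    intro i
    have := hcon i
    rwa [isUnit_iff_not_dvd hϖ, not_not] at this
  have hdet : IsUnit (x * 0 - 1 * 1 : O) := by simp
  have hdet' : IsUnit (1 * 1 - 0 * 0 : O) := by simp
  have m1 : columnVertex O (P * extendGL K (integralGL x 1 1 0 hdet) * diagonalGL 1 (p ^ (r + 1))) ∈
      stableVertices O (Set.range M) := by
    refine columnVertex_mem_range.2 fun i => ?_
    rw [columnVertex_branch_mem_stableVertices hp (hB i)]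
    obtain ⟨q, hq⟩ := hdvd i
    refine ⟨-q, ?_⟩
    rw [pow_succ, pow_add]
    linear_combination -ϖ ^ r * hq
  have m2 : columnVertex O (P * extendGL K (integralGL 1 0 0 1 hdet') * diagonalGL 1 (p ^ (r + l))) ∈
      stableVertices O (Set.range M) := by
    refine columnVertex_mem_range.2 fun i => ?_
    rw [columnVertex_branch_mem_stableVertices hp (hB i)]
    exact ⟨c i, by ring⟩
  have := hX _ m1 _ m2
  rw [dist_transverse hϖ hp P x 1 1 0 1 0 0 1 hdet hdet' (by simp)] at this
  omega

/-- The mirror image: seen from the other end of the nerve, b and c are exchanged and a changes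
sign. -/
theorem exists_isUnit_lower (hϖ : Irreducible ϖ) (hp : (p : K) = algebraMap O K ϖ)
    {P : GL (Fin 2) K} {r l : ℕ} {t a b c : ι → O}
    (hB : ∀ i, (P⁻¹).val * M i * P.val = !![t i + ϖ ^ r * a i, ϖ ^ r * b i;
      ϖ ^ (r + l) * c i, t i - ϖ ^ r * a i].map (algebraMap O K))
    (hX : ∀ x ∈ stableVertices O (Set.range M), ∀ y ∈ stableVertices O (Set.range M),
      (tree O K).dist x y ≤ 2 * r + l) (x : O) :
    ∃ i, IsUnit (2 * -a i * x + c i - ϖ ^ l * b i * x ^ 2) := by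
  refine exists_isUnit_upper (P := P * diagonalGL 1 (p ^ l) * extendGL K (swapGL : GL (Fin 2) O)) (t := t)
    (a := fun i => -a i) (b := c) (c := b) hϖ hp (fun i => ?_) hX x
  have := hB i
  rw [map_fin_two] at this
  have hp0 := p.ne_zero
  rw [conj_swapGL (conj_diagonalGL this _), map_fin_two]
  ext i j
  fin_cases i <;> fin_cases j <;> simp [pow_add, ← hp] <;>
    first | (field_simp; done) | ring1

/-- If ϖ divided every a, all matrices would be scalar modulo ϖ^(r+1) at the vertex one step along
the frame (this needs l ≥ 2), and a ball of radius r + 1 would lie in the band. -/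
theorem exists_isUnit_diagonal (hϖ : Irreducible ϖ) (hp : (p : K) = algebraMap O K ϖ)
    {P : GL (Fin 2) K} {r l : ℕ} (hl : 2 ≤ l) {t a b c : ι → O}
    (hB : ∀ i, (P⁻¹).val * M i * P.val = !![t i + ϖ ^ r * a i, ϖ ^ r * b i;
      ϖ ^ (r + l) * c i, t i - ϖ ^ r * a i].map (algebraMap O K))
    {S : Set (Vertex O K)} (hS : IsSegment S) (hX : stableVertices O (Set.range M) = band S r) :
    ∃ i, IsUnit (a i) := by
  by_contra! hcon
  simp only [isUnit_iff_not_dvd hϖ, not_not] at hcon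
  refine not_ball_subset_band hS r (columnVertex O (P * diagonalGL 1 p)) ?_
  rw [← hX]
  intro y hy
  refine mem_stableVertices_of_dist_le hϖ hp hy ?_
  rintro _ ⟨i, rfl⟩
  obtain ⟨a', ha'⟩ := hcon i
  obtain ⟨l, rfl⟩ := Nat.exists_eq_add_of_le' hl
  refine ⟨t i, !![a', b i; ϖ ^ l * c i, -a'].map (algebraMap O K), ⟨_, rfl⟩, ?_⟩
  have := hB i
  rw [map_fin_two] at this
  have hp0 := p.ne_zero
  rw [conj_diagonalGL this, map_fin_two, ha']
  ext i j
  fin_cases i <;> fin_cases j <;> simp [pow_add, ← hp, -algebraMap_smul] <;>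
    first | (field_simp; done) | ring1

end Frames

/-! ### The trace form is not a square modulo ϖ^(d+1). -/

section Discriminant

/-- For the traceless matrices N = (a, b; c, -a) the hypothesis reads 2 tr(NᵢNⱼ) = eᵢeⱼ, and the
conclusion is a common eigenvector (x, y). Either the span contains a nonzero nilpotent orthogonal
to everything, whose kernel works, or all N are multiples of one matrix with square discriminant. -/
theorem exists_common_isotropic {k ι : Type*} [Field k] (h2 : (2 : k) ≠ 0) (a b c e : ι → k)
    (h : ∀ i j, e i * e j = 4 * a i * a j + 2 * (b i * c j + b j * c i)) :
    ∃ x y : k, (x ≠ 0 ∨ y ≠ 0) ∧ ∀ i, 2 * a i * x * y + b i * y ^ 2 - c i * x ^ 2 = 0 := by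
  have nilp : ∀ a₀ b₀ c₀ : k, (a₀ ≠ 0 ∨ b₀ ≠ 0 ∨ c₀ ≠ 0) → 4 * a₀ * a₀ + 4 * (b₀ * c₀) = 0 →
      (∀ i, 4 * a₀ * a i + 2 * (b₀ * c i + b i * c₀) = 0) →
      ∃ x y : k, (x ≠ 0 ∨ y ≠ 0) ∧ ∀ i, 2 * a i * x * y + b i * y ^ 2 - c i * x ^ 2 = 0 := by
    intro a₀ b₀ c₀ hne h0 hi
    have h0' : a₀ * a₀ + b₀ * c₀ = 0 := by
      have : (2 * 2) * (a₀ * a₀ + b₀ * c₀) = 0 := by linear_combination h0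
      simpa [h2] using this
    have hi' : ∀ i, 2 * a₀ * a i + (b₀ * c i + b i * c₀) = 0 := by
      intro i
      have : 2 * (2 * a₀ * a i + (b₀ * c i + b i * c₀)) = 0 := by linear_combination hi i
      simpa [h2] using this
    by_cases hc : c₀ = 0
    · subst hc
      have ha : a₀ = 0 := by simpa using h0'
      subst ha
      have hb : b₀ ≠ 0 := by simpa using hne
      refine ⟨1, 0, Or.inl one_ne_zero, fun i => ?_⟩
      have := hi' i
      have hc : c i = 0 := by simpa [hb] using this
      simp [hc]
    · exact ⟨a₀, c₀, Or.inr hc, fun i => by linear_combination c₀ * hi' i - c i * h0'⟩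
  by_cases he : ∀ i, e i = 0
  · by_cases h0 : ∀ i, a i = 0 ∧ b i = 0 ∧ c i = 0
    · exact ⟨1, 0, Or.inl one_ne_zero, fun i => by simp [(h0 i).1, (h0 i).2.1, (h0 i).2.2]⟩
    · push Not at h0
      obtain ⟨i, hi⟩ := h0
      refine nilp (a i) (b i) (c i) ?_ ?_ fun j => ?_
      · by_contra! h'
        exact hi h'.1 h'.2.1 h'.2.2
      · have := h i i
        rw [he i] at this
        linear_combination -this
      · have := h i j
        rw [he i] at this
        linear_combination -this
  push Not at he
  obtain ⟨i, hi⟩ := he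
  by_cases h0 : ∀ j, e i * a j = e j * a i ∧ e i * b j = e j * b i ∧ e i * c j = e j * c i
  · obtain ⟨s, hs⟩ : ∃ s, e i = 2 * s := ⟨e i / 2, by field_simp⟩
    have hs0 : s ≠ 0 := by
      rintro rfl
      simp [hs] at hi
    have hsq : s * s = a i * a i + b i * c i := by
      have := h i i
      rw [hs] at this
      have : (2 * 2) * (s * s - (a i * a i + b i * c i)) = 0 := by linear_combination this
      simpa [h2, sub_eq_zero] using this
    suffices hline : ∃ x y : k, (x ≠ 0 ∨ y ≠ 0) ∧ 2 * a i * x * y + b i * y ^ 2 - c i * x ^ 2 = 0 by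
      obtain ⟨x, y, hxy, hl⟩ := hline
      refine ⟨x, y, hxy, fun j => ?_⟩
      obtain ⟨h1, h2, h3⟩ := h0 j
      have : e i * (2 * a j * x * y + b j * y ^ 2 - c j * x ^ 2) = 0 := by
        linear_combination 2 * x * y * h1 + y ^ 2 * h2 - x ^ 2 * h3 + e j * hl
      simpa [hi] using this
    -- An eigenvector for the eigenvalue s is (b, s - a), unless this vanishes; then (2s, c) serves.
    by_cases hb : b i = 0 ∧ a i = s
    · refine ⟨2 * s, c i, Or.inl (by simp [h2, hs0]), ?_⟩
      rw [hb.1, hb.2]; ring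
    · refine ⟨b i, s - a i, ?_, ?_⟩
      · by_contra! h'
        exact hb ⟨h'.1, (sub_eq_zero.1 h'.2).symm⟩
      · linear_combination b i * hsq
  · push Not at h0
    obtain ⟨j, hj⟩ := h0
    -- The linear form e vanishes on this combination, so it lies in the radical of the trace form.
    refine nilp (e i * a j - e j * a i) (e i * b j - e j * b i) (e i * c j - e j * c i) ?_ ?_
      fun m => ?_
    · by_contra! h'
      exact hj (sub_eq_zero.1 h'.1) (sub_eq_zero.1 h'.2.1) (sub_eq_zero.1 h'.2.2)
    · linear_combination -(e i) ^ 2 * h j j - (e j) ^ 2 * h i i + 2 * e i * e j * h i j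
    · linear_combination -e i * h j m + e j * h i m

variable {O : Type*} [CommRing O] [IsDomain O] [IsDiscreteValuationRing O] {ϖ : O} {ι : Type*}

/-- If a_i is a unit, take x with 2 a_i x = -b_i and j from the hypothesis at this x: a_i b_j - a_j
b_i equals a_i (2 a_j x + b_j), a unit since l ≥ 1. -/
theorem exists_combination (hϖ : Irreducible ϖ) (h2 : IsUnit (2 : O)) {l : ℕ} (hl : 1 ≤ l)
    (a b c : ι → O)
    (h : ∀ x : O, ∃ i, IsUnit (2 * a i * x + b i - ϖ ^ l * c i * x ^ 2)) :
    ∃ (α β : O) (i j : ι), ϖ ∣ α * a i + β * a j ∧ IsUnit (α * b i + β * b j) := by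
  obtain ⟨i, hi⟩ := h 0
  have hbi : IsUnit (b i) := by simpa using hi
  by_cases ha : IsUnit (a i)
  · obtain ⟨x, hx⟩ : ∃ x, 2 * a i * x = -b i := by
      obtain ⟨u, hu⟩ := (h2.mul ha).exists_right_inv
      exact ⟨u * -b i, by linear_combination -b i * hu⟩
    obtain ⟨j, hj⟩ := h x
    refine ⟨a i, -a j, j, i, ⟨0, by ring⟩, ?_⟩
    have : a i * b j + -a j * b i = a i * (2 * a j * x + b j) := by
      linear_combination -a j * hx
    rw [this]
    refine ha.mul ?_
    rw [isUnit_iff_not_dvd hϖ] at hj ⊢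
    refine fun hd => hj (dvd_sub hd ?_)
    exact Dvd.dvd.mul_right (Dvd.dvd.mul_right (dvd_pow_self _ (by omega)) _) _
  · refine ⟨1, 0, i, i, ?_, by simpa using hbi⟩
    rw [isUnit_iff_not_dvd hϖ, not_not] at ha
    simpa using ha

/-- If a discriminant is a square modulo `ϖ ^ (l + 1)`, one of the nondegeneracy conditions
imposed by the geometry fails. -/
theorem not_square_discriminant (hϖ : Irreducible ϖ) (h2 : IsUnit (2 : O)) {l : ℕ}
    (a b c e : ι → O)
    (hpair : ∀ i j, ϖ ^ (l + 1) ∣ e i * e j -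
      (4 * a i * a j + 2 * ϖ ^ l * (b i * c j + b j * c i)))
    (hu : ∀ x : O, ∃ i, IsUnit (2 * a i * x + b i - ϖ ^ l * c i * x ^ 2))
    (hlow : ∀ x : O, ∃ i, IsUnit (2 * -a i * x + c i - ϖ ^ l * b i * x ^ 2))
    (hdiag : 2 ≤ l → ∃ i, IsUnit (a i)) : False := by
  have hpr := hϖ.prime
  have h2' : ¬ ϖ ∣ 2 := (isUnit_iff_not_dvd hϖ).1 h2
  rcases Nat.eq_zero_or_pos l with rfl | hl
  -- For l = 0 a common eigenvector exists over the residue field; its direction contradicts `hlow`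
  -- at 0 if it is (1, 0), and `hu` otherwise.
  · have hred : ∀ a : O, ϖ ∣ a ↔ residue O a = 0 := by
      intro a
      rw [residue_eq_zero_iff, hϖ.maximalIdeal_eq, Ideal.mem_span_singleton]
    obtain ⟨x, y, hxy, hline⟩ := exists_common_isotropic (k := ResidueField O)
      (by rw [← map_ofNat (residue O), Ne, ← hred]; exact h2')
      (fun i => residue O (a i)) (fun i => residue O (b i)) (fun i => residue O (c i))
      (fun i => residue O (e i)) (by
        intro i j
        have := hpair i j
        rw [zero_add, pow_one, hred] at this
        simp only [map_sub, map_mul, map_add, map_ofNat, map_one, pow_zero] at this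
        linear_combination this)
    by_cases hy : y = 0
    · subst hy
      have hx : x ≠ 0 := by simpa using hxy
      obtain ⟨i, hi⟩ := hlow 0
      have := hline i
      have hc : residue O (c i) = 0 := by simpa [hx] using this
      rw [← hred] at hc
      rw [isUnit_iff_not_dvd hϖ] at hi
      simp at hi
      exact hi hc
    · obtain ⟨z, hz⟩ := residue_surjective (x / y)
      obtain ⟨i, hi⟩ := hu z
      rw [isUnit_iff_not_dvd hϖ, hred] at hi
      apply hi
      have := hline i
      simp only [map_sub, map_mul, map_add, map_pow, map_ofNat, map_one, pow_zero, hz]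
      field_simp
      linear_combination this
  -- The congruence is bilinear, so it extends from the family to its span and may be tested on
  -- suitable combinations.
  let V : Submodule O (O × O × O × O) :=
    Submodule.span O (Set.range fun i => (a i, b i, c i, e i))
  have hmem : ∀ i, (a i, b i, c i, e i) ∈ V := fun i => Submodule.subset_span ⟨i, rfl⟩
  have hV₁ : ∀ i, ∀ w ∈ V, ϖ ^ (l + 1) ∣ e i * w.2.2.2 -
      (4 * a i * w.1 + 2 * ϖ ^ l * (b i * w.2.2.1 + w.2.1 * c i)) := by
    intro i w hw
    induction hw using Submodule.span_induction with
    | mem w hw => obtain ⟨j, rfl⟩ := hw; exact hpair i j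
    | zero => simp
    | add w w' _ _ h h' =>
      have := dvd_add h h'
      simp only [Prod.fst_add, Prod.snd_add]
      convert this using 1
      ring
    | smul x w _ h =>
      have := Dvd.dvd.mul_left h x
      simp only [Prod.smul_fst, Prod.smul_snd, smul_eq_mul]
      convert this using 1
      ring
  have hV : ∀ v ∈ V, ∀ w ∈ V, ϖ ^ (l + 1) ∣ v.2.2.2 * w.2.2.2 -
      (4 * v.1 * w.1 + 2 * ϖ ^ l * (v.2.1 * w.2.2.1 + w.2.1 * v.2.2.1)) := by
    intro v hv w hw
    induction hv using Submodule.span_induction with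
    | mem v hv => obtain ⟨j, rfl⟩ := hv; exact hV₁ j w hw
    | zero => simp
    | add v v' _ _ h h' =>
      have := dvd_add h h'
      simp only [Prod.fst_add, Prod.snd_add]
      convert this using 1
      ring
    | smul x v _ h =>
      have := Dvd.dvd.mul_left h x
      simp only [Prod.smul_fst, Prod.smul_snd, smul_eq_mul]
      convert this using 1
      ring
  -- With a unit a_i, e_i is also a unit: subtracting a multiple of that element kills the first
  -- coordinate, and pairing with it makes ϖ^l divide the last. Without one, l = 1 and e² ≡ 0
  -- suffices.
  have improve : ∀ v ∈ V, ϖ ∣ v.1 → ∃ v' ∈ V, ϖ ^ l ∣ v'.1 ∧ ϖ ^ l ∣ v'.2.2.2 ∧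
      (IsUnit v.2.1 → IsUnit v'.2.1) ∧ (IsUnit v.2.2.1 → IsUnit v'.2.2.1) := by
    intro v hv hv1
    by_cases h3 : ∃ i, IsUnit (a i)
    · obtain ⟨i, hi⟩ := h3
      have hei : IsUnit (e i) := by
        rw [isUnit_iff_not_dvd hϖ] at hi ⊢
        intro hd
        have h4 : ϖ ∣ e i * e i - (4 * a i * a i + 2 * ϖ ^ l * (b i * c i + b i * c i)) :=
          (dvd_pow_self _ (by omega)).trans (hpair i i)
        have h5 : ϖ ∣ 2 * 2 * (a i * a i) := by
          have h6 : ϖ ∣ 2 * ϖ ^ l * (b i * c i + b i * c i) :=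
            ((dvd_pow_self _ (by omega)).mul_left _).mul_right _
          have := dvd_sub (dvd_sub (hd.mul_right (e i)) h4) h6
          convert this using 1; ring
        rcases hpr.dvd_or_dvd h5 with h | h <;> rcases hpr.dvd_or_dvd h with h | h <;> tauto
      refine ⟨a i • v - v.1 • (a i, b i, c i, e i),
        sub_mem (V.smul_mem _ hv) (V.smul_mem _ (hmem i)), ?_, ?_, fun h => ?_, fun h => ?_⟩
      · simp [mul_comm]
      · have h4 := hV₁ i _ (sub_mem (V.smul_mem (a i) hv) (V.smul_mem v.1 (hmem i)))
        have h5 := (pow_dvd_pow ϖ (Nat.le_succ l)).trans h4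
        have h6 : (a i • v - v.1 • (a i, b i, c i, e i)).1 = 0 := by simp [mul_comm]
        rw [h6, mul_zero, zero_add] at h5
        have h7 := (dvd_sub_right ((dvd_mul_left _ _).mul_right _)).1 ((dvd_sub_comm).1 h5)
        exact hei.dvd_mul_left.1 h7
      · have : (a i • v - v.1 • (a i, b i, c i, e i)).2.1 = a i * v.2.1 - v.1 * b i := by simp
        rw [this]
        have hu' := hi.mul h
        rw [isUnit_iff_not_dvd hϖ] at hu' ⊢
        exact fun hd => hu' ((dvd_sub_left (hv1.mul_right _)).1 hd)
      · have : (a i • v - v.1 • (a i, b i, c i, e i)).2.2.1 = a i * v.2.2.1 - v.1 * c i := by simp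
        rw [this]
        have hu' := hi.mul h
        rw [isUnit_iff_not_dvd hϖ] at hu' ⊢
        exact fun hd => hu' ((dvd_sub_left (hv1.mul_right _)).1 hd)
    · have hl1 : l = 1 := by
        by_contra hne
        exact h3 (hdiag (by omega))
      subst hl1
      refine ⟨v, hv, by simpa using hv1, ?_, id, id⟩
      rw [pow_one] at *
      have h4 := (dvd_pow_self ϖ two_ne_zero).trans (hV v hv v hv)
      have h5 : ϖ ∣ 4 * v.1 * v.1 + 2 * ϖ * (v.2.1 * v.2.2.1 + v.2.1 * v.2.2.1) :=
        dvd_add (hv1.mul_left _) ((dvd_mul_left _ _).mul_right _)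
      have h6 := (dvd_sub_left h5).1 h4
      rcases hpr.dvd_or_dvd h6 with h | h <;> exact h
  -- Since 2l ≥ l + 1, the a- and e-terms disappear and ϖ^l cancels from the rest.
  have hcancel : ∀ v ∈ V, ∀ w ∈ V, ϖ ^ l ∣ v.1 → ϖ ^ l ∣ v.2.2.2 → ϖ ^ l ∣ w.1 →
      ϖ ^ l ∣ w.2.2.2 → ϖ ∣ v.2.1 * w.2.2.1 + w.2.1 * v.2.2.1 := by
    intro v hv w hw h1 h2 h3 h4
    have h5 := hV v hv w hw
    have hll : ϖ ^ (l + 1) ∣ ϖ ^ l * ϖ ^ l := by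
      rw [← pow_add]; exact pow_dvd_pow _ (by omega)
    have h6 := hll.trans (mul_dvd_mul h2 h4)
    have h7 : ϖ ^ (l + 1) ∣ 4 * v.1 * w.1 := by
      rw [mul_assoc]
      exact (hll.trans (mul_dvd_mul h1 h3)).mul_left _
    have h8 := (dvd_add_right h7).1 ((dvd_sub_right h6).1 h5)
    rw [pow_succ, mul_comm 2, mul_assoc] at h8
    have h9 := (mul_dvd_mul_iff_left (pow_ne_zero l hϖ.ne_zero)).1 h8
    exact (hpr.dvd_or_dvd h9).resolve_left h2'
  obtain ⟨α, β, i, j, hd, hub⟩ := exists_combination hϖ h2 hl a b c hu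
  obtain ⟨α', β', i', j', hd', hub'⟩ := exists_combination hϖ h2 hl (fun i => -a i) c b hlow
  obtain ⟨v, hv, hv1, hv2, hv3, -⟩ := improve (α • (a i, b i, c i, e i) + β • (a j, b j, c j, e j))
    (add_mem (V.smul_mem _ (hmem i)) (V.smul_mem _ (hmem j))) (by simpa using hd)
  obtain ⟨w, hw, hw1, hw2, -, hw3⟩ :=
    improve (α' • (a i', b i', c i', e i') + β' • (a j', b j', c j', e j'))
    (add_mem (V.smul_mem _ (hmem i')) (V.smul_mem _ (hmem j'))) (by
      rw [← dvd_neg]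
      convert hd' using 1
      simp
      ring)
  have hvb := (isUnit_iff_not_dvd hϖ).1 (hv3 (by simpa using hub))
  have hwc := (isUnit_iff_not_dvd hϖ).1 (hw3 (by simpa using hub'))
  -- Here v has unit b and w has unit c. Pairing v with itself gives ϖ ∣ c(v), and pairing it with w
  -- then gives ϖ ∣ b(v)c(w).
  have hvv := hcancel v hv v hv hv1 hv2 hv1 hv2
  have hvw := hcancel v hv w hw hv1 hv2 hw1 hw2
  have hvc : ϖ ∣ v.2.2.1 := by
    rw [← two_mul] at hvv
    exact (hpr.dvd_or_dvd ((hpr.dvd_or_dvd hvv).resolve_left h2')).resolve_left hvb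
  have := (dvd_add_left (hvc.mul_left w.2.1)).1 hvw
  exact (hpr.dvd_or_dvd this).elim hvb hwc

theorem pow_dvd_of_sq {r n : ℕ} {D s : O} (hn : 2 * r ≤ n)
    (h : ϖ ^ n ∣ D * D - ϖ ^ (2 * r) * s) : ϖ ^ r ∣ D := by
  have h1 := (pow_dvd_pow ϖ hn).trans h
  have h2 := (dvd_sub_left (dvd_mul_right _ _)).1 h1
  rw [mul_comm 2, pow_mul, ← pow_two] at h2
  exact (IsIntegrallyClosed.pow_dvd_pow_iff two_ne_zero).1 h2

theorem not_square_discriminant_pow (hϖ : Irreducible ϖ) (h2 : IsUnit (2 : O)) {l r : ℕ}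
    (a b c D : ι → O)
    (hpair : ∀ i j, ϖ ^ (2 * r + l + 1) ∣ D i * D j -
      ϖ ^ (2 * r) * (4 * a i * a j + 2 * ϖ ^ l * (b i * c j + b j * c i)))
    (hu : ∀ x : O, ∃ i, IsUnit (2 * a i * x + b i - ϖ ^ l * c i * x ^ 2))
    (hlow : ∀ x : O, ∃ i, IsUnit (2 * -a i * x + c i - ϖ ^ l * b i * x ^ 2))
    (hdiag : 2 ≤ l → ∃ i, IsUnit (a i)) : False := by
  have hD : ∀ i, ϖ ^ r ∣ D i := fun i => pow_dvd_of_sq (by omega) (hpair i i)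
  choose e he using hD
  refine not_square_discriminant hϖ h2 a b c e (fun i j => ?_) hu hlow hdiag
  have := hpair i j
  rw [he, he] at this
  have h3 : ϖ ^ r * e i * (ϖ ^ r * e j) -
      ϖ ^ (2 * r) * (4 * a i * a j + 2 * ϖ ^ l * (b i * c j + b j * c i)) =
      ϖ ^ (2 * r) * (e i * e j - (4 * a i * a j + 2 * ϖ ^ l * (b i * c j + b j * c i))) := by ring
  rw [h3, add_assoc, pow_add] at this
  exact (mul_dvd_mul_iff_left (pow_ne_zero _ hϖ.ne_zero)).1 this

end Discriminant

/-! ### Conjugate characters in coordinates. -/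

section Characters

variable {O K G : Type*} [CommRing O] [IsDomain O] [IsDiscreteValuationRing O]
  [Field K] [Algebra O K] [IsFractionRing O K] [Group G] {ϖ : O}
  {ρ : G →* GL (Fin 2) K} {P : GL (Fin 2) K}

theorem quadratic_eq_iff {R : Type*} [CommRing R] (s q x y : R) :
    (Polynomial.X ^ 2 - Polynomial.C s * Polynomial.X + Polynomial.C q : Polynomial R) =
      (Polynomial.X - Polynomial.C x) * (Polynomial.X - Polynomial.C y) ↔
      x + y = s ∧ x * y = q := by
  constructor
  · intro h
    have h0 := congrArg (Polynomial.eval 0) h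
    have h1 := congrArg (Polynomial.eval 1) h
    simp at h0 h1
    exact ⟨by linear_combination h1 - h0, h0.symm⟩
  · rintro ⟨rfl, rfl⟩
    simp only [map_add, map_mul]
    ring

theorem isConjugatePair_iff {B : G → Matrix (Fin 2) (Fin 2) O}
    (hB : ∀ g, (P⁻¹).val * (ρ g).val * P.val = (B g).map (algebraMap O K)) {n : ℕ}
    {χ₁ χ₂ : G →* (O ⧸ maximalIdeal O ^ n)ˣ} :
    IsConjugatePair ρ n χ₁ χ₂ ↔ ∀ g,
      (χ₁ g).val + (χ₂ g).val = Ideal.Quotient.mk _ (B g).trace ∧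
      (χ₁ g).val * (χ₂ g).val = Ideal.Quotient.mk _ (B g).det := by
  refine forall_congr' fun g => ?_
  have h1 : ((B g).charpoly).map (algebraMap O K) =
      (ρ g : Matrix (Fin 2) (Fin 2) K).charpoly := by
    rw [← Matrix.charpoly_map, ← hB]
    simp
  have h2 : ((B g).charpoly).map (Ideal.Quotient.mk (maximalIdeal O ^ n)) =
      Polynomial.X ^ 2 - Polynomial.C (Ideal.Quotient.mk (maximalIdeal O ^ n) (B g).trace) *
        Polynomial.X + Polynomial.C (Ideal.Quotient.mk (maximalIdeal O ^ n) (B g).det) := by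
    rw [Matrix.charpoly_fin_two]
    simp
  rw [← quadratic_eq_iff, ← h2]
  constructor
  · rintro ⟨Q, hQ, hQ'⟩
    rw [← hQ', Polynomial.map_injective _ (IsFractionRing.injective O K) (hQ.trans h1.symm)]
  · exact fun h => ⟨_, h1, h⟩

theorem matrix_mul_of_conj {B : G → Matrix (Fin 2) (Fin 2) O}
    (hB : ∀ g, (P⁻¹).val * (ρ g).val * P.val = (B g).map (algebraMap O K)) (g h : G) :
    B (g * h) = B g * B h := by
  apply Matrix.map_injective (IsFractionRing.injective O K)
  beta_reduce
  rw [Matrix.map_mul, ← hB, ← hB, ← hB, map_mul, Units.val_mul]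
  simp only [mul_assoc, Units.mul_inv_cancel_left]

theorem matrix_one_of_conj {B : G → Matrix (Fin 2) (Fin 2) O}
    (hB : ∀ g, (P⁻¹).val * (ρ g).val * P.val = (B g).map (algebraMap O K)) : B 1 = 1 := by
  apply Matrix.map_injective (IsFractionRing.injective O K)
  beta_reduce
  rw [← hB, map_one, Matrix.map_one _ (map_zero _) (map_one _)]
  simp

theorem mk_eq_zero_iff_dvd (hϖ : Irreducible ϖ) {n : ℕ} {x : O} :
    Ideal.Quotient.mk (maximalIdeal O ^ n) x = 0 ↔ ϖ ^ n ∣ x := by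
  rw [Ideal.Quotient.eq_zero_iff_mem, hϖ.maximalIdeal_eq, Ideal.span_singleton_pow,
    Ideal.mem_span_singleton]

theorem mk_mem_map_iff_dvd (hϖ : Irreducible ϖ) {m n : ℕ} (hmn : m ≤ n) {x : O} :
    Ideal.Quotient.mk (maximalIdeal O ^ n) x ∈
      (maximalIdeal O ^ m).map (Ideal.Quotient.mk (maximalIdeal O ^ n)) ↔ ϖ ^ m ∣ x := by
  rw [Ideal.mem_quotient_iff_mem (Ideal.pow_le_pow_right hmn), hϖ.maximalIdeal_eq,
    Ideal.span_singleton_pow, Ideal.mem_span_singleton]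

theorem isCongruenceIndex_self {n : ℕ} (χ : G →* (O ⧸ maximalIdeal O ^ n)ˣ) :
    IsCongruenceIndex χ χ n :=
  ⟨⟨le_rfl, fun g => by simp⟩, fun _ h => h.1⟩

section Coordinates

variable {t a b c : G → O} {r l : ℕ}

theorem two_mul_trace_mul (hB : ∀ g, (P⁻¹).val * (ρ g).val * P.val = !![t g + ϖ ^ r * a g,
      ϖ ^ r * b g; ϖ ^ (r + l) * c g, t g - ϖ ^ r * a g].map (algebraMap O K)) (g h : G) :
    2 * t (g * h) = 2 * t g * t h +
      ϖ ^ (2 * r) * (2 * a g * a h + ϖ ^ l * (b g * c h + b h * c g)) := by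
  have h1 := matrix_mul_of_conj (B := fun g => !![t g + ϖ ^ r * a g,
      ϖ ^ r * b g; ϖ ^ (r + l) * c g, t g - ϖ ^ r * a g]) hB g h
  have h2 := congrArg Matrix.trace h1
  rw [Matrix.mul_fin_two, Matrix.trace_fin_two_of, Matrix.trace_fin_two_of] at h2
  have h3 : ϖ ^ (r + l) * ϖ ^ r = ϖ ^ (2 * r) * ϖ ^ l := by ring
  linear_combination h2

/-- Polarisation: (χ₁ - χ₂)(g)(χ₁ - χ₂)(h) = 2(χ₁ + χ₂)(gh) - (χ₁ + χ₂)(g)(χ₁ + χ₂)(h), and the sums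
are traces. -/
theorem exists_difference (hϖ : Irreducible ϖ)
    (hB : ∀ g, (P⁻¹).val * (ρ g).val * P.val = !![t g + ϖ ^ r * a g,
      ϖ ^ r * b g; ϖ ^ (r + l) * c g, t g - ϖ ^ r * a g].map (algebraMap O K)) {n : ℕ}
    {χ₁ χ₂ : G →* (O ⧸ maximalIdeal O ^ n)ˣ} (hχ : IsConjugatePair ρ n χ₁ χ₂) :
    ∃ D : G → O, (∀ g, Ideal.Quotient.mk _ (D g) = (χ₁ g).val - (χ₂ g).val) ∧
      ∀ g h, ϖ ^ n ∣ D g * D h -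
        ϖ ^ (2 * r) * (4 * a g * a h + 2 * ϖ ^ l * (b g * c h + b h * c g)) := by
  have hsum : ∀ g, (χ₁ g).val + (χ₂ g).val = Ideal.Quotient.mk _ (2 * t g) := by
    intro g
    rw [((isConjugatePair_iff hB).1 hχ g).1, Matrix.trace_fin_two_of]
    ring_nf
  choose D hD using fun g =>
    Ideal.Quotient.mk_surjective ((χ₁ g).val - (χ₂ g).val)
  refine ⟨D, hD, fun g h => ?_⟩
  have hgh := hsum (g * h)
  rw [map_mul, map_mul, Units.val_mul, Units.val_mul, two_mul_trace_mul hB g h, map_add] at hgh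
  have hg := hsum g
  have hh := hsum h
  have e1 : D g * D h - ϖ ^ (2 * r) * (4 * a g * a h + 2 * ϖ ^ l * (b g * c h + b h * c g)) =
      D g * D h - (2 * (2 * t g * t h + ϖ ^ (2 * r) * (2 * a g * a h +
        ϖ ^ l * (b g * c h + b h * c g))) - (2 * t g) * (2 * t h)) := by ring
  rw [← mk_eq_zero_iff_dvd hϖ, e1, map_sub, map_sub, map_mul, map_mul _ 2, map_add, ← hgh,
    map_mul _ (2 * t g), ← hg, ← hh, hD, hD, map_ofNat]
  ring

theorem not_isConjugatePair (hϖ : Irreducible ϖ) (h2 : IsUnit (2 : O))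
    (hB : ∀ g, (P⁻¹).val * (ρ g).val * P.val = !![t g + ϖ ^ r * a g,
      ϖ ^ r * b g; ϖ ^ (r + l) * c g, t g - ϖ ^ r * a g].map (algebraMap O K))
    (hu : ∀ x : O, ∃ i, IsUnit (2 * a i * x + b i - ϖ ^ l * c i * x ^ 2))
    (hlow : ∀ x : O, ∃ i, IsUnit (2 * -a i * x + c i - ϖ ^ l * b i * x ^ 2))
    (hdiag : 2 ≤ l → ∃ i, IsUnit (a i)) {n : ℕ}
    {χ₁ χ₂ : G →* (O ⧸ maximalIdeal O ^ n)ˣ} (hχ : IsConjugatePair ρ n χ₁ χ₂) :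
    n ≤ 2 * r + l := by
  by_contra! hn
  obtain ⟨D, -, hD⟩ := exists_difference hϖ hB hχ
  exact not_square_discriminant_pow hϖ h2 a b c D
    (fun i j => (pow_dvd_pow ϖ hn).trans (hD i j)) hu hlow hdiag

/-- D(g)² is congruent to 4ϖ^(2r)a(g)² modulo ϖ^(2r+1) because l ≥ 1; a congruence modulo ϖ^(r+1)
would make the left side vanish there. -/
theorem isCongruenceIndex_of_isUnit (hϖ : Irreducible ϖ) (h2 : IsUnit (2 : O)) (hl : 1 ≤ l)
    (hB : ∀ g, (P⁻¹).val * (ρ g).val * P.val = !![t g + ϖ ^ r * a g,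
      ϖ ^ r * b g; ϖ ^ (r + l) * c g, t g - ϖ ^ r * a g].map (algebraMap O K))
    (ha : ∃ g, IsUnit (a g))
    {χ₁ χ₂ : G →* (O ⧸ maximalIdeal O ^ (2 * r + l))ˣ}
    (hχ : IsConjugatePair ρ (2 * r + l) χ₁ χ₂) : IsCongruenceIndex χ₁ χ₂ r := by
  obtain ⟨D, hmk, hD⟩ := exists_difference hϖ hB hχ
  constructor
  · refine ⟨by omega, fun g => ?_⟩
    rw [← hmk, mk_mem_map_iff_dvd hϖ (by omega)]
    exact pow_dvd_of_sq (by omega) (hD g g)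
  · rintro m ⟨hm, hm'⟩
    by_contra! hlt
    obtain ⟨g, hg⟩ := ha
    have h1 := hm' g
    rw [← hmk, mk_mem_map_iff_dvd hϖ hm] at h1
    have h1' := (pow_dvd_pow ϖ (show r + 1 ≤ m from hlt)).trans h1
    have h3 : ϖ ^ (2 * r + 1) ∣ D g * D g := by
      refine (pow_dvd_pow ϖ (show 2 * r + 1 ≤ (r + 1) + (r + 1) by omega)).trans ?_
      rw [pow_add]
      exact mul_dvd_mul h1' h1'
    have h4 := (dvd_sub_right h3).1
      ((pow_dvd_pow ϖ (show 2 * r + 1 ≤ 2 * r + l by omega)).trans (hD g g))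
    rw [pow_succ] at h4
    have h5 := (mul_dvd_mul_iff_left (pow_ne_zero _ hϖ.ne_zero)).1 h4
    have h6 : ϖ ∣ 2 * ϖ ^ l * (b g * c g + b g * c g) :=
      ((dvd_pow_self _ (by omega)).mul_left _).mul_right _
    have h7 := (dvd_add_left h6).1 h5
    have h8 : IsUnit (4 * a g * a g) := by
      have : (4 : O) = 2 * 2 := by norm_num
      rw [this]
      exact ((h2.mul h2).mul hg).mul hg
    exact (isUnit_iff_not_dvd hϖ).1 h8 h7

/-- The characters are the diagonal entries: products of an upper and a lower off-diagonal entry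
vanish modulo ϖ^(2r+l). -/
theorem exists_isConjugatePair (hϖ : Irreducible ϖ)
    (hB : ∀ g, (P⁻¹).val * (ρ g).val * P.val = !![t g + ϖ ^ r * a g,
      ϖ ^ r * b g; ϖ ^ (r + l) * c g, t g - ϖ ^ r * a g].map (algebraMap O K)) :
    ∃ χ₁ χ₂ : G →* (O ⧸ maximalIdeal O ^ (2 * r + l))ˣ,
      IsConjugatePair ρ (2 * r + l) χ₁ χ₂ := by
  have h0 : ∀ x, Ideal.Quotient.mk (maximalIdeal O ^ (2 * r + l)) (ϖ ^ (2 * r + l) * x) = 0 :=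
    fun x => (mk_eq_zero_iff_dvd hϖ).2 (dvd_mul_right _ _)
  have hone := matrix_one_of_conj (B := fun g => !![t g + ϖ ^ r * a g,
      ϖ ^ r * b g; ϖ ^ (r + l) * c g, t g - ϖ ^ r * a g]) hB
  have hmul := matrix_mul_of_conj (B := fun g => !![t g + ϖ ^ r * a g,
      ϖ ^ r * b g; ϖ ^ (r + l) * c g, t g - ϖ ^ r * a g]) hB
  simp only [Matrix.mul_fin_two] at hmul
  let f₁ : G →* O ⧸ maximalIdeal O ^ (2 * r + l) :=
    { toFun := fun g => Ideal.Quotient.mk _ (t g + ϖ ^ r * a g)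
      map_one' := by
        have := congrFun (congrFun hone 0) 0
        simp only [Matrix.of_apply, Matrix.cons_val_zero, Matrix.one_apply_eq, Matrix.cons_val',
          Matrix.cons_val_fin_one] at this
        rw [this, map_one]
      map_mul' := fun g h => by
        have := congrFun (congrFun (hmul g h) 0) 0
        simp only [Matrix.of_apply, Matrix.cons_val_zero, Matrix.cons_val',
          Matrix.cons_val_fin_one] at this
        rw [← map_mul, this, map_add, add_eq_left, ← h0 (b g * c h)]
        congr 1
        ring }
  let f₂ : G →* O ⧸ maximalIdeal O ^ (2 * r + l) :=
    { toFun := fun g => Ideal.Quotient.mk _ (t g - ϖ ^ r * a g)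
      map_one' := by
        have := congrFun (congrFun hone 1) 1
        simp only [Matrix.of_apply, Matrix.cons_val_one, Matrix.one_apply_eq, Matrix.cons_val',
          Matrix.cons_val_fin_one] at this
        rw [this, map_one]
      map_mul' := fun g h => by
        have := congrFun (congrFun (hmul g h) 1) 1
        simp only [Matrix.of_apply, Matrix.cons_val_one, Matrix.cons_val',
          Matrix.cons_val_fin_one] at this
        rw [← map_mul, this, map_add, add_eq_right, ← h0 (b h * c g)]
        congr 1
        ring }
  refine ⟨f₁.toHomUnits, f₂.toHomUnits, (isConjugatePair_iff hB).2 fun g => ?_⟩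
  rw [MonoidHom.coe_toHomUnits, MonoidHom.coe_toHomUnits, Matrix.trace_fin_two_of,
    Matrix.det_fin_two_of, map_sub _ _ (ϖ ^ r * b g * (ϖ ^ (r + l) * c g))]
  have h3 : ϖ ^ r * b g * (ϖ ^ (r + l) * c g) = ϖ ^ (2 * r + l) * (b g * c g) := by ring
  rw [h3, h0, sub_zero]
  exact ⟨(map_add (Ideal.Quotient.mk _) _ _).symm, (map_mul (Ideal.Quotient.mk _) _ _).symm⟩

/-- The character is the half trace t: under `ha` the deviation of t from multiplicativity and that
of the determinant from t² are divisible by ϖ^(2r+l). -/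
theorem exists_isConjugatePair_self (hϖ : Irreducible ϖ) (h2 : IsUnit (2 : O))
    (hB : ∀ g, (P⁻¹).val * (ρ g).val * P.val = !![t g + ϖ ^ r * a g,
      ϖ ^ r * b g; ϖ ^ (r + l) * c g, t g - ϖ ^ r * a g].map (algebraMap O K))
    (ha : ∀ g h, ϖ ^ l ∣ a g * a h) :
    ∃ χ : G →* (O ⧸ maximalIdeal O ^ (2 * r + l))ˣ, IsConjugatePair ρ (2 * r + l) χ χ := by
  have h0 : ∀ x, Ideal.Quotient.mk (maximalIdeal O ^ (2 * r + l)) (ϖ ^ (2 * r + l) * x) = 0 :=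
    fun x => (mk_eq_zero_iff_dvd hϖ).2 (dvd_mul_right _ _)
  have h2' : IsUnit (2 : O ⧸ maximalIdeal O ^ (2 * r + l)) := by
    have := h2.map (Ideal.Quotient.mk (maximalIdeal O ^ (2 * r + l)))
    rwa [map_ofNat] at this
  have hone := matrix_one_of_conj (B := fun g => !![t g + ϖ ^ r * a g,
      ϖ ^ r * b g; ϖ ^ (r + l) * c g, t g - ϖ ^ r * a g]) hB
  let f : G →* O ⧸ maximalIdeal O ^ (2 * r + l) :=
    { toFun := fun g => Ideal.Quotient.mk _ (t g)
      map_one' := by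
        have h3 := congrArg Matrix.trace hone
        rw [Matrix.trace_fin_two_of, Matrix.trace_one, Fintype.card_fin] at h3
        have h4 : 2 * t 1 = 2 * 1 := by push_cast at h3; linear_combination h3
        rw [h2.mul_left_cancel h4, map_one]
      map_mul' := fun g h => by
        obtain ⟨q, hq⟩ := ha g h
        have h3 := congrArg (Ideal.Quotient.mk (maximalIdeal O ^ (2 * r + l)))
          (two_mul_trace_mul hB g h)
        have h4 : 2 * t g * t h + ϖ ^ (2 * r) * (2 * a g * a h + ϖ ^ l * (b g * c h + b h * c g)) =
            2 * (t g * t h) + ϖ ^ (2 * r + l) * (2 * q + (b g * c h + b h * c g)) := by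
          rw [mul_assoc 2 (a g), hq]; ring
        rw [h4, map_add, h0, add_zero, map_mul, map_mul _ 2, map_mul _ (t g), map_ofNat] at h3
        exact h2'.mul_left_cancel h3 }
  refine ⟨f.toHomUnits, (isConjugatePair_iff hB).2 fun g => ?_⟩
  rw [MonoidHom.coe_toHomUnits, Matrix.trace_fin_two_of, Matrix.det_fin_two_of]
  obtain ⟨q, hq⟩ := ha g g
  have h3 : (t g + ϖ ^ r * a g) * (t g - ϖ ^ r * a g) - ϖ ^ r * b g * (ϖ ^ (r + l) * c g) =
      t g * t g + ϖ ^ (2 * r + l) * (-q - b g * c g) := by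
    have : (t g + ϖ ^ r * a g) * (t g - ϖ ^ r * a g) = t g * t g - ϖ ^ (2 * r) * (a g * a g) := by
      ring
    rw [this, hq]; ring
  rw [h3, map_add _ (t g * t g), h0, add_zero]
  refine ⟨?_, (map_mul (Ideal.Quotient.mk _) _ _).symm⟩
  change Ideal.Quotient.mk _ (t g) + Ideal.Quotient.mk _ (t g) = _
  rw [← map_add]
  congr 1
  ring

end Coordinates

end Characters

/-! ### Fixed sets of single elements, and thinness when l = 1. -/

section ThinElements

variable {O K : Type*} [CommRing O] [IsDomain O] [IsDiscreteValuationRing O]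
  [Field K] [Algebra O K] [IsFractionRing O K] {ϖ : O} {p : Kˣ}

theorem le_of_pow_dvd_mul (hϖ : Irreducible ϖ) {k n : ℕ} {u : O} (hu : ¬ ϖ ∣ u)
    (h : ϖ ^ k ∣ ϖ ^ n * u) : k ≤ n := by
  by_contra! hlt
  have := (pow_dvd_pow ϖ hlt).trans h
  rw [pow_succ] at this
  exact hu ((mul_dvd_mul_iff_left (pow_ne_zero _ hϖ.ne_zero)).1 this)

theorem exists_pow_dvd_le (hϖ : Irreducible ϖ) {k r : ℕ} {y : O} (h : ϖ ^ k ∣ ϖ ^ r * y) :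
    ∃ m ≤ k, ϖ ^ m ∣ y ∧ k ≤ r + m := by
  by_cases hy : y = 0
  · exact ⟨k, le_rfl, by simp [hy], by omega⟩
  obtain ⟨m, u, rfl⟩ := IsDiscreteValuationRing.eq_unit_mul_pow_irreducible hy hϖ
  refine ⟨min m k, min_le_right _ _, (pow_dvd_pow ϖ (min_le_left _ _)).mul_left _, ?_⟩
  have h1 : ϖ ^ k ∣ ϖ ^ (r + m) * u := by
    rw [pow_add]
    convert h using 1
    ring
  have := le_of_pow_dvd_mul hϖ ((isUnit_iff_not_dvd hϖ).1 u.isUnit) h1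
  omega

/-- The vertices on the apartment attached to a basis. -/
def apartment (p : Kˣ) (P : GL (Fin 2) K) (i : ℤ) : Vertex O K :=
  columnVertex O (P * diagonalGL 1 (p ^ i))

theorem dist_apartment (hϖ : Irreducible ϖ) (hp : (p : K) = algebraMap O K ϖ) (P : GL (Fin 2) K)
    (i j : ℤ) : ((tree O K).dist (apartment p P i) (apartment p P j) : ℤ) = |i - j| := by
  have key : ∀ i j : ℤ, i ≤ j →
      ((tree O K).dist (apartment p P i) (apartment p P j) : ℤ) = |i - j| := by
    intro i j hij
    obtain ⟨k, rfl⟩ := Int.le.dest hij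
    rw [apartment, apartment, dist_columnVertex_diagonalGL hϖ hp P 1 (p ^ i) 1 (p ^ (i + k : ℤ)) k
      (by rw [one_mul, mul_one, zpow_add, zpow_natCast, mul_comm])]
    simp
  rcases le_total i j with h | h
  · exact key i j h
  · rw [SimpleGraph.dist_comm, abs_sub_comm]
    exact key j i h

/-- A vertex stable under a diagonal matrix is close to the apartment. -/
theorem exists_dist_apartment_le (hϖ : Irreducible ϖ) (hp : (p : K) = algebraMap O K ϖ)
    (P : GL (Fin 2) K) {r : ℕ} (x y z w : O) (h : IsUnit (x * w - z * y)) {k : ℕ}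
    (hxy : ϖ ^ k ∣ ϖ ^ r * (x * y)) :
    ∃ i : ℤ, (tree O K).dist
      (columnVertex O (P * extendGL K (integralGL x z y w h) * diagonalGL 1 (p ^ k)))
      (apartment p P i) ≤ r := by
  rcases isUnit_or_isUnit_of_det h with hx | hy
  · have h1 : ϖ ^ k ∣ ϖ ^ r * y := by
      rw [mul_left_comm, hx.dvd_mul_left] at hxy
      exact hxy
    -- The branch follows the apartment for m steps; the remaining k - m steps number at most r.
    obtain ⟨m, hm, ⟨y', rfl⟩, hk⟩ := exists_pow_dvd_le hϖ h1
    obtain ⟨n, rfl⟩ := Nat.exists_eq_add_of_le hm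
    have hdet : IsUnit (x * 1 - 0 * (ϖ ^ m * y')) := by simpa using hx
    have hdet' : IsUnit (x * 1 - 0 * y') := by simpa using hx
    refine ⟨m, ?_⟩
    rw [columnVertex_branch_congr hp P x _ z w 0 1 h hdet]
    have h2 : P * extendGL K (integralGL x 0 (ϖ ^ m * y') 1 hdet) * diagonalGL 1 (p ^ (m + n)) =
        (P * diagonalGL 1 (p ^ (m : ℤ))) * extendGL K (integralGL x 0 y' 1 hdet') *
          diagonalGL 1 (p ^ n) := by
      rw [mul_assoc P, mul_assoc P, mul_assoc P]
      congr 1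
      refine Units.ext ?_
      simp only [Units.val_mul, val_extendGL_integralGL, val_diagonalGL, Matrix.mul_fin_two]
      ext i j
      fin_cases i <;> fin_cases j <;> simp [← hp, pow_add]
    rw [h2, SimpleGraph.dist_comm, apartment, dist_branch hϖ hp]
    omega
  · have h1 : ϖ ^ k ∣ ϖ ^ r * x := by
      rw [← mul_assoc, hy.dvd_mul_right] at hxy
      exact hxy
    obtain ⟨m, hm, ⟨x', rfl⟩, hk⟩ := exists_pow_dvd_le hϖ h1
    obtain ⟨n, rfl⟩ := Nat.exists_eq_add_of_le hm
    have hdet : IsUnit (ϖ ^ m * x' * 0 - 1 * y) := by simpa using hy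
    have hdet' : IsUnit (x' * 0 - 1 * y) := by simpa using hy
    refine ⟨-m, ?_⟩
    rw [columnVertex_branch_congr hp P _ y z w 1 0 h hdet]
    have h2 : P * extendGL K (integralGL (ϖ ^ m * x') 1 y 0 hdet) * diagonalGL 1 (p ^ (m + n)) =
        (p ^ m • (P * diagonalGL 1 (p ^ (-m : ℤ)))) * extendGL K (integralGL x' 1 y 0 hdet') *
          diagonalGL 1 (p ^ n) := by
      rw [← mul_smul_comm, mul_assoc P, mul_assoc P, mul_assoc P]
      congr 1
      refine Units.ext ?_
      simp only [Units.val_mul, Units.val_smul, val_extendGL_integralGL, val_diagonalGL,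
        Matrix.mul_fin_two, Units.smul_def, Matrix.smul_of, Matrix.smul_cons, Matrix.smul_empty]
      ext i j
      fin_cases i <;> fin_cases j <;> simp [← hp, pow_add]
    rw [h2, SimpleGraph.dist_comm, apartment, ← columnVertex_smul (p ^ m), dist_branch hϖ hp]
    omega

theorem isInfiniteBand_of_diagonal (hϖ : Irreducible ϖ) (hp : (p : K) = algebraMap O K ϖ)
    (h2 : IsUnit (2 : O)) {P : GL (Fin 2) K} {M : Matrix (Fin 2) (Fin 2) K} {r : ℕ} {t s : O}
    (hs : IsUnit s) (hM : (P⁻¹).val * M * P.val =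
      !![t + ϖ ^ r * s, 0; 0, t - ϖ ^ r * s].map (algebraMap O K)) :
    IsInfiniteBand (stableVertices O {M}) r := by
  refine ⟨apartment p P '' Set.univ, ⟨Set.univ, apartment p P, Set.univ_nonempty,
    Set.ordConnected_univ, fun i _ j _ => dist_apartment hϖ hp P i j, rfl⟩, ?_, ?_⟩
  · refine Set.infinite_univ.image fun i _ j _ hij => ?_
    have := dist_apartment hϖ hp P i j
    rw [hij, SimpleGraph.dist_self] at this
    exact sub_eq_zero.1 (abs_eq_zero.1 this.symm)
  ext y
  constructor
  · intro hy
    obtain ⟨U, k, rfl⟩ := exists_branch hϖ hp P y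
    obtain ⟨x, y, z, w, h, rfl⟩ := exists_first_column U
    rw [columnVertex_branch_mem_stableVertices hp hM] at hy
    have h3 : x * (0 * x + (t - ϖ ^ r * s) * y) - y * ((t + ϖ ^ r * s) * x + 0 * y) =
        -(2 * s) * (ϖ ^ r * (x * y)) := by ring
    rw [h3, (h2.mul hs).neg.dvd_mul_left] at hy
    obtain ⟨i, hi⟩ := exists_dist_apartment_le hϖ hp P x y z w h hy
    exact ⟨_, ⟨i, trivial, rfl⟩, hi⟩
  · rintro ⟨_, ⟨i, -, rfl⟩, hi⟩
    rw [SimpleGraph.dist_comm] at hi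
    refine mem_stableVertices_of_dist_le hϖ hp hi ?_
    rintro _ rfl
    refine ⟨t, !![s, 0; 0, -s].map (algebraMap O K), ⟨_, rfl⟩, ?_⟩
    rw [map_fin_two] at hM
    rw [conj_diagonalGL hM, map_fin_two]
    ext i j
    fin_cases i <;> fin_cases j <;> simp [← hp, -algebraMap_smul]
    ring

theorem exists_sq_eq [IsAdicComplete (maximalIdeal O) O] (h2 : IsUnit (2 : O)) {a q : O}
    (ha : IsUnit a) (hq : q ∈ maximalIdeal O) :
    ∃ s, s * s = a * a + q ∧ s - a ∈ maximalIdeal O := by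
  obtain ⟨s, hs, hsa⟩ := HenselianRing.is_henselian (I := maximalIdeal O)
    (Polynomial.X ^ 2 - Polynomial.C (a * a + q)) (Polynomial.monic_X_pow_sub_C _ two_ne_zero) a
    (by
      simp only [Polynomial.eval_sub, Polynomial.eval_pow, Polynomial.eval_X, Polynomial.eval_C]
      have : a ^ 2 - (a * a + q) = -q := by ring
      rw [this]
      exact neg_mem hq)
    (by
      simp only [Polynomial.derivative_sub, Polynomial.derivative_X_pow, Polynomial.derivative_C]
      refine IsUnit.map _ ?_
      simpa using ⟨h2, ha⟩)
  refine ⟨s, ?_, hsa⟩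
  simp only [Polynomial.IsRoot, Polynomial.eval_sub, Polynomial.eval_pow, Polynomial.eval_X,
    Polynomial.eval_C] at hs
  linear_combination hs

/-- By Hensel a² + ϖbc has a root s ≡ a, so the matrix is diagonalisable over O: the eigenvectors (a
+ s, ϖc) and (-b, a + s) have determinant 2s(a + s), a unit. -/
theorem isInfiniteBand_of_isUnit [IsAdicComplete (maximalIdeal O) O] (hϖ : Irreducible ϖ)
    (hp : (p : K) = algebraMap O K ϖ) (h2 : IsUnit (2 : O)) {P : GL (Fin 2) K}
    {M : Matrix (Fin 2) (Fin 2) K} {r : ℕ} {t a b c : O} (ha : IsUnit a)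
    (hM : (P⁻¹).val * M * P.val =
      !![t + ϖ ^ r * a, ϖ ^ r * b; ϖ ^ (r + 1) * c, t - ϖ ^ r * a].map (algebraMap O K)) :
    IsInfiniteBand (stableVertices O {M}) r := by
  have hmem : ∀ x : O, x ∈ maximalIdeal O ↔ ϖ ∣ x := fun x => by
    rw [hϖ.maximalIdeal_eq, Ideal.mem_span_singleton]
  obtain ⟨s, hs, hsa⟩ := exists_sq_eq h2 ha ((hmem (ϖ * (b * c))).2 (dvd_mul_right _ _))
  rw [hmem] at hsa
  have has : IsUnit (a + s) := by
    have h3 := h2.mul ha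
    rw [isUnit_iff_not_dvd hϖ] at h3 ⊢
    intro hd
    apply h3
    convert dvd_sub hd hsa using 1
    ring
  have hsu : IsUnit s := by
    rw [isUnit_iff_not_dvd hϖ] at ha ⊢
    exact fun hd => ha ((dvd_sub_right hd).1 hsa)
  have hdet : IsUnit ((a + s) * (a + s) - -b * (ϖ * c)) := by
    have h3 : (a + s) * (a + s) - -b * (ϖ * c) = 2 * s * (a + s) := by
      linear_combination -hs
    rw [h3]
    exact (h2.mul hsu).mul has
  refine isInfiniteBand_of_diagonal (t := t) (P := P * extendGL K (integralGL _ _ _ _ hdet))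
    hϖ hp h2 hsu ?_
  have h3 : ((P * extendGL K (integralGL _ _ _ _ hdet))⁻¹).val * M *
      (P * extendGL K (integralGL _ _ _ _ hdet)).val =
      (extendGL K (integralGL _ _ _ _ hdet))⁻¹.val * (((P⁻¹).val * M * P.val) *
        (extendGL K (integralGL _ _ _ _ hdet)).val) := by
    simp only [mul_inv_rev, Units.val_mul, mul_assoc]
  have h4 : !![t + ϖ ^ r * a, ϖ ^ r * b; ϖ ^ (r + 1) * c, t - ϖ ^ r * a] *
      !![a + s, -b; ϖ * c, a + s] =
      !![a + s, -b; ϖ * c, a + s] * !![t + ϖ ^ r * s, 0; 0, t - ϖ ^ r * s] := by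
    rw [Matrix.mul_fin_two, Matrix.mul_fin_two]
    ext i j
    fin_cases i <;> fin_cases j <;> simp
    · linear_combination -ϖ ^ r * hs
    · ring
    · ring
    · linear_combination ϖ ^ r * hs
  rw [h3, hM, val_extendGL, val_integralGL, ← Matrix.map_mul, h4, Matrix.map_mul]
  exact Units.inv_mul_cancel_left (extendGL K (integralGL _ _ _ _ hdet)) _

/-- If ϖ also divides b or c, the fixed set contains a ball of radius r + 1 around one of the two
vertices of the frame. Otherwise it is bounded. -/
theorem not_isInfiniteBand_of_dvd (hϖ : Irreducible ϖ) (hp : (p : K) = algebraMap O K ϖ)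
    {P : GL (Fin 2) K} {M : Matrix (Fin 2) (Fin 2) K} {r : ℕ} {t a b c : O} (ha : ϖ ∣ a)
    (hM : (P⁻¹).val * M * P.val =
      !![t + ϖ ^ r * a, ϖ ^ r * b; ϖ ^ (r + 1) * c, t - ϖ ^ r * a].map (algebraMap O K)) :
    ¬ IsInfiniteBand (stableVertices O {M}) r := by
  rintro ⟨S, hS, hinf, hX⟩
  have hpr := hϖ.prime
  have hp0 := p.ne_zero
  have hM' := hM
  rw [map_fin_two] at hM'
  by_cases hb : ϖ ∣ b
  · obtain ⟨a', rfl⟩ := ha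
    obtain ⟨b', rfl⟩ := hb
    refine not_ball_subset_band hS r (columnVertex O P) ?_
    rw [← hX]
    intro y hy
    refine mem_stableVertices_of_dist_le hϖ hp hy ?_
    rintro _ rfl
    refine ⟨t, !![a', b'; c, -a'].map (algebraMap O K), ⟨_, rfl⟩, ?_⟩
    rw [hM', map_fin_two]
    ext i j
    fin_cases i <;> fin_cases j <;> simp [← hp, pow_succ, -algebraMap_smul] <;> ring
  by_cases hc : ϖ ∣ c
  · obtain ⟨a', rfl⟩ := ha
    obtain ⟨c', rfl⟩ := hc
    refine not_ball_subset_band hS r (columnVertex O (P * diagonalGL 1 p)) ?_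
    rw [← hX]
    intro y hy
    refine mem_stableVertices_of_dist_le hϖ hp hy ?_
    rintro _ rfl
    refine ⟨t, !![a', b; c', -a'].map (algebraMap O K), ⟨_, rfl⟩, ?_⟩
    rw [conj_diagonalGL hM', map_fin_two]
    ext i j
    fin_cases i <;> fin_cases j <;> simp [← hp, pow_succ, -algebraMap_smul] <;>
      first | (field_simp; done) | ring1
  -- One term of the eigenvector condition dominates: ϖ^(r+1)cx² if ϖ ∣ y, and ϖ^r by² otherwise.
  have hbound : ∀ y ∈ stableVertices O {M}, (tree O K).dist (columnVertex O P) y ≤ r + 1 := by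
    intro y hy
    obtain ⟨U, k, rfl⟩ := exists_branch hϖ hp P y
    obtain ⟨x, y, z, w, h, rfl⟩ := exists_first_column U
    rw [columnVertex_branch_mem_stableVertices hp hM] at hy
    rw [dist_branch hϖ hp]
    obtain ⟨a', rfl⟩ := ha
    by_cases hy' : ϖ ∣ y
    · obtain ⟨y', rfl⟩ := hy'
      have hx : ¬ ϖ ∣ x := by
        rw [isUnit_iff_not_dvd hϖ] at h
        exact fun hd => h (dvd_sub (hd.mul_right _) (by
          rw [mul_left_comm]; exact dvd_mul_right _ _))
      refine le_of_pow_dvd_mul (u := c * (x * x) - ϖ * (2 * a' * x * y' + b * y' ^ 2)) hϖ ?_ ?_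
      · rw [dvd_sub_left (dvd_mul_right _ _)]
        intro hd
        rcases hpr.dvd_or_dvd hd with h | h
        · exact hc h
        · exact (hpr.dvd_or_dvd h).elim hx hx
      · convert hy using 1
        ring
    · refine (le_of_pow_dvd_mul (n := r) (u := b * (y * y) - ϖ * (c * x ^ 2 - 2 * a' * x * y))
        hϖ ?_ ?_).trans r.le_succ
      · rw [dvd_sub_left (dvd_mul_right _ _)]
        intro hd
        rcases hpr.dvd_or_dvd hd with h | h
        · exact hb h
        · exact (hpr.dvd_or_dvd h).elim hy' hy'
      · rw [← dvd_neg]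
        convert hy using 1
        ring
  obtain ⟨I, f, ⟨i, hi⟩, -, hf, rfl⟩ := hS
  have hfX : ∀ j ∈ I, f j ∈ stableVertices O {M} := by
    intro j hj
    rw [hX]
    exact ⟨f j, ⟨j, hj, rfl⟩, by simp⟩
  refine hinf (((Set.finite_Icc (i - (2 * r + 2)) (i + (2 * r + 2))).subset fun j hj => ?_).image f)
  have h1 := hbound _ (hfX i hi)
  have h2 := hbound _ (hfX j hj)
  have h3 := (tree_connected (O := O) (K := K)).dist_triangle (u := f i) (v := columnVertex O P)
    (w := f j)
  rw [SimpleGraph.dist_comm (u := f i) (v := columnVertex O P)] at h3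
  have h4 := hf i hi j hj
  rw [Set.mem_Icc]
  have h5 : |i - j| ≤ 2 * r + 2 := by omega
  rw [abs_le] at h5
  constructor <;> omega

end ThinElements

theorem isUnit_two_of_ringChar {O : Type*} [CommRing O] [IsLocalRing O]
    (h : ringChar (IsLocalRing.ResidueField O) ≠ 2) : IsUnit (2 : O) := by
  by_contra hu
  rw [← mem_nonunits_iff, ← IsLocalRing.mem_maximalIdeal, ← IsLocalRing.residue_eq_zero_iff,
    map_ofNat] at hu
  exact Ring.two_ne_zero h hu

end BruhatTits

/-! ### The theorem. -/

theorem theorem4p2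
    {O K G : Type*} [CommRing O] [IsDomain O] [IsDiscreteValuationRing O]
    [IsAdicComplete (IsLocalRing.maximalIdeal O) O]
    [Field K] [Algebra O K] [IsFractionRing O K]
    (hchar : ringChar (IsLocalRing.ResidueField O) ≠ 2)
    [Group G] (ρ : G →* Matrix.GeneralLinearGroup (Fin 2) K)
    (hirr : (BruhatTits.toRepresentation ρ).IsIrreducible)
    (d r : ℕ)
    (hband : BruhatTits.IsFiniteBand (BruhatTits.fixedTree O ρ) r)
    (hdiam : BruhatTits.HasDiameter (BruhatTits.fixedTree O ρ) d) :
    BruhatTits.reducibilityIndex O ρ = d ∧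
    (d = 2 * r → BruhatTits.IsMultiplicityIndex O ρ d) ∧
    (d = 2 * r + 1 → (¬ ∃ g : G, BruhatTits.IsThin O ρ r g) →
      BruhatTits.IsMultiplicityIndex O ρ d) ∧
    (¬ (d = 2 * r ∨ (d = 2 * r + 1 ∧ ¬ ∃ g : G, BruhatTits.IsThin O ρ r g)) →
      BruhatTits.IsMultiplicityIndex O ρ r) := by
  open BruhatTits in
  obtain ⟨ϖ, p, hϖ, hp⟩ := exists_uniformizer O K
  have h2 := isUnit_two_of_ringChar hchar
  obtain ⟨P, l, rfl, hball, hball'⟩ := exists_frame hϖ hp hband hdiam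
  have hmono : ∀ g : G, fixedTree O ρ ⊆ stableVertices O {(ρ g).val} := by
    rintro g _ ⟨Λ, rfl, hΛ⟩
    refine ⟨Λ, rfl, ?_⟩
    rintro _ rfl
    exact hΛ _ ⟨g, rfl⟩
  choose t a b c hB using fun g : G => exists_coordinates hϖ hp h2
    (fun y hy => hmono g (hball y hy)) (fun y hy => hmono g (hball' y hy))
  have hX : ∀ x ∈ fixedTree O ρ, ∀ y ∈ fixedTree O ρ, (tree O K).dist x y ≤ 2 * r + l :=
    fun x hx y hy => hdiam.2 ⟨x, hx, y, hy, rfl⟩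
  have hu := exists_isUnit_upper hϖ hp hB hX
  have hlow := exists_isUnit_lower hϖ hp hB hX
  have hdiag : 2 ≤ l → ∃ g, IsUnit (a g) := by
    intro hl
    obtain ⟨S, hS, -, hband⟩ := hband
    exact exists_isUnit_diagonal hϖ hp hl hB hS hband
  have hred : reducibilityIndex O ρ = ((2 * r + l : ℕ) : ℕ∞) := by
    refine le_antisymm (iSup₂_le ?_) ?_
    · rintro n ⟨χ₁, χ₂, hχ⟩
      exact_mod_cast not_isConjugatePair hϖ h2 hB hu hlow hdiag hχ
    · exact le_iSup₂ (f := fun (n : ℕ) (_ : n ∈ {n : ℕ | ∃ χ₁ χ₂ : G →*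
        (O ⧸ IsLocalRing.maximalIdeal O ^ n)ˣ, IsConjugatePair ρ n χ₁ χ₂}) => (n : ℕ∞))
        (2 * r + l) (exists_isConjugatePair hϖ hB)
  have hmax : (∀ g h, ϖ ^ l ∣ a g * a h) → IsMultiplicityIndex O ρ (2 * r + l) := by
    intro ha
    obtain ⟨χ, hχ⟩ := exists_isConjugatePair_self hϖ h2 hB ha
    refine ⟨_, hred, ⟨χ, χ, hχ, isCongruenceIndex_self χ⟩, ?_⟩
    rintro m ⟨χ₁, χ₂, -, hm⟩
    exact hm.1.1
  -- All pairs have the same index r, so the maximum can be read off from any one of them.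
  have hmin : 1 ≤ l → (∃ g, IsUnit (a g)) → IsMultiplicityIndex O ρ r := by
    intro hl ha
    obtain ⟨χ₁, χ₂, hχ⟩ := exists_isConjugatePair hϖ hB
    refine ⟨_, hred, ⟨χ₁, χ₂, hχ, isCongruenceIndex_of_isUnit hϖ h2 hl hB ha hχ⟩, ?_⟩
    rintro m ⟨ψ₁, ψ₂, hψ, hm⟩
    exact (hm.unique (isCongruenceIndex_of_isUnit hϖ h2 hl hB ha hψ)).le
  have hthin : l = 1 → ∀ g, IsThin O ρ r g ↔ IsUnit (a g) := by
    rintro rfl g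
    constructor
    · intro hg
      by_contra ha
      rw [isUnit_iff_not_dvd hϖ, not_not] at ha
      exact not_isInfiniteBand_of_dvd hϖ hp ha (hB g) hg
    · exact fun ha => isInfiniteBand_of_isUnit hϖ hp h2 ha (hB g)
  refine ⟨hred, fun hd => hmax ?_, fun hd hno => hmax ?_, fun hne => ?_⟩
  · obtain rfl : l = 0 := by omega
    simp
  · obtain rfl : l = 1 := by omega
    intro g h
    have ha : ¬ IsUnit (a g) := fun ha => hno ⟨g, (hthin rfl g).2 ha⟩
    rw [isUnit_iff_not_dvd hϖ, not_not] at ha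
    simpa using ha.mul_right (a h)
  · push Not at hne
    have hl : 1 ≤ l := by omega
    refine hmin hl ?_
    rcases hl.eq_or_lt with h | h
    · obtain ⟨g, hg⟩ := hne.2 (by omega)
      exact ⟨g, (hthin h.symm g).1 hg⟩
    · exact hdiag h
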